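/- **Theorem 2.4 (oracle bound).** There are numerical constants $K, C, D, d > 0$ such that the following holds for all integers $n, m, r \ge 1$, all matrices $A_1,\dots,A_m \in \mathbb{R}^{n\times n}$, every $M \in \mathbb{R}^{n\times n}$ with $\operatorname{rank}(M) = r$, and every $\sigma \ge 0$. Let $\mathcal{A}(X) = (\langle A_i, X\rangle)_{i\le m}$, where $\langle A_i, X\rangle = \operatorname{Tr}(A_i^{T}X)$, and $\mathcal{A}^*(v) = \sum_{i\le m} v_i A_i$. Let $\delta_k$ be the smallest $\delta$ such that $$(1-\delta)\|X\|_F^2 \le \|\mathcal{A}(X)\|_{\ell_2}^2 \le (1+\delta)\|X\|_F^2$$ for all $X \in \mathbb{R}^{n\times n}$ of rank at most $k$, and suppose that $\delta_{4r} < \sqrt2 - 1$. Let $y = \mathcal{A}(M) + z$, where the entries of $z \in \mathbb{R}^m$ are independent $N(0,\sigma^2)$ random variables, and let $\lambda = K\sqrt n\,\sigma$. Then, with probability at least $1 - D e^{-dn}$, the problem $$\text{minimize } \|X\|_* \quad\text{subject to}\quad \|\mathcal{A}^*(y - \mathcal{A}(X))\| \le \lambda$$ (nuclear norm $\|\cdot\|_*$,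 operator norm $\|\cdot\|$) has a solution, and every solution $\hat M$ satisfies $$\|\hat M - M\|_F^2 \le C \sum_{i=1}^{r} \min(\sigma_i^2, n\sigma^2),$$ where $\sigma_1 \ge \dots \ge \sigma_r > 0$ are the nonzero singular values of $M$. -/

import Mathlib

open MeasureTheory ProbabilityTheory

noncomputable section

namespace LowRank

/-- The squared Frobenius norm `∑ i j, X i j ^ 2`. -/
def frobSq {n : ℕ} (X : Matrix (Fin n) (Fin n) ℝ) : ℝ :=
  ∑ i, ∑ j, X i j ^ 2

/-- The operator norm of `X` as a map between Euclidean spaces (its largest singular value). -/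
def opNorm {n : ℕ} (X : Matrix (Fin n) (Fin n) ℝ) : ℝ :=
  ‖Matrix.toEuclideanCLM (n := Fin n) (𝕜 := ℝ) X‖

/-- The singular values of `X` in decreasing order, indexed from `0` (and `0` from index `n` on). -/
def singVal {n : ℕ} (X : Matrix (Fin n) (Fin n) ℝ) (i : ℕ) : ℝ :=
  (Matrix.toEuclideanLin X).singularValues i

/-- The nuclear norm: the sum of all singular values. -/
def nuclearNorm {n : ℕ} (X : Matrix (Fin n) (Fin n) ℝ) : ℝ :=
  ∑ i ∈ Finset.range n, singVal X i

/-- The linear measurement operator `X ↦ (⟨A₁, X⟩, …, ⟨Aₘ, X⟩)`, with `⟨Y, X⟩ = Tr (Yᵀ X)`. -/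
def meas {m n : ℕ} (A : Fin m → Matrix (Fin n) (Fin n) ℝ)
    (X : Matrix (Fin n) (Fin n) ℝ) : Fin m → ℝ :=
  fun i => Matrix.trace ((A i).transpose * X)

/-- The adjoint of the measurement operator, `v ↦ ∑ i, vᵢ Aᵢ`. -/
def measAdj {m n : ℕ} (A : Fin m → Matrix (Fin n) (Fin n) ℝ)
    (v : Fin m → ℝ) : Matrix (Fin n) (Fin n) ℝ :=
  ∑ i, v i • A i

/-- `δ` satisfies the restricted isometry inequalities at rank `k`. -/
def RestrictedIsometry {m n : ℕ} (A : Fin m → Matrix (Fin n) (Fin n) ℝ) (k : ℕ) (δ : ℝ) : Prop :=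
  ∀ X : Matrix (Fin n) (Fin n) ℝ, X.rank ≤ k →
    (1 - δ) * frobSq X ≤ ∑ i, meas A X i ^ 2 ∧ ∑ i, meas A X i ^ 2 ≤ (1 + δ) * frobSq X

/-- The isometry constant `δ_k`: the smallest `δ` satisfying the restricted isometry inequalities
for all matrices of rank at most `k`. For `1 ≤ k` and `1 ≤ n` the infimum is a minimum; for `n ≤ k`
all matrices are allowed. -/
def isometryConst {m n : ℕ} (A : Fin m → Matrix (Fin n) (Fin n) ℝ) (k : ℕ) : ℝ :=
  sInf {δ : ℝ | RestrictedIsometry A k δ}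

theorem frobSq_nonneg {n : ℕ} (X : Matrix (Fin n) (Fin n) ℝ) : 0 ≤ frobSq X :=
  Finset.sum_nonneg fun _ _ => Finset.sum_nonneg fun _ _ => sq_nonneg _

theorem meas_sq_le {m n : ℕ} (A : Fin m → Matrix (Fin n) (Fin n) ℝ)
    (X : Matrix (Fin n) (Fin n) ℝ) (i : Fin m) :
    meas A X i ^ 2 ≤ frobSq (A i) * frobSq X := by
  have h : meas A X i = ∑ p : Fin n × Fin n, A i p.1 p.2 * X p.1 p.2 := by
    simp only [meas, Matrix.trace, Matrix.diag, Matrix.mul_apply, Matrix.transpose_apply]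
    rw [Finset.sum_comm, Fintype.sum_prod_type]
  have e : ∀ Y : Matrix (Fin n) (Fin n) ℝ, frobSq Y = ∑ p : Fin n × Fin n, Y p.1 p.2 ^ 2 :=
    fun Y => by rw [frobSq, Fintype.sum_prod_type]
  rw [h, e, e]
  exact Finset.sum_mul_sq_le_sq_mul_sq _ _ _

/-- The infimum defining `isometryConst` is attained, so it is the smallest admissible `δ`. -/
theorem isLeast_isometryConst {m n k : ℕ} (A : Fin m → Matrix (Fin n) (Fin n) ℝ)
    (hn : 1 ≤ n) (hk : 1 ≤ k) :
    IsLeast {δ : ℝ | RestrictedIsometry A k δ} (isometryConst A k) := by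
  have hne : {δ : ℝ | RestrictedIsometry A k δ}.Nonempty := by
    refine ⟨1 + ∑ i, frobSq (A i), fun X _ => ?_⟩
    have hX := frobSq_nonneg X
    have hA : 0 ≤ ∑ i, frobSq (A i) := Finset.sum_nonneg fun i _ => frobSq_nonneg _
    have h0 : 0 ≤ ∑ i, meas A X i ^ 2 := Finset.sum_nonneg fun i _ => sq_nonneg _
    have h1 : ∑ i, meas A X i ^ 2 ≤ (∑ i, frobSq (A i)) * frobSq X := by
      rw [Finset.sum_mul]
      exact Finset.sum_le_sum fun i _ => meas_sq_le A X i
    constructor <;> nlinarith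
  have hbdd : BddBelow {δ : ℝ | RestrictedIsometry A k δ} := by
    refine ⟨0, fun δ hδ => ?_⟩
    let v : Fin n → ℝ := fun _ => 1
    have hr : (Matrix.vecMulVec v v).rank ≤ k := (Matrix.rank_vecMulVec_le v v).trans hk
    have hpos : 0 < frobSq (Matrix.vecMulVec v v) := by
      have : (1 : ℝ) ≤ n := by exact_mod_cast hn
      simp [frobSq, Matrix.vecMulVec_apply, v]
      omega
    have h := hδ _ hr
    nlinarith [h.1.trans h.2]
  refine ⟨fun X hX => ?_, fun δ hδ => csInf_le hbdd hδ⟩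
  have key : ∀ ε : ℝ, 0 < ε → ∃ δ, RestrictedIsometry A k δ ∧ δ < isometryConst A k + ε :=
    fun ε hε => exists_lt_of_csInf_lt hne (lt_add_of_pos_right _ hε)
  have hF := frobSq_nonneg X
  constructor <;> refine le_of_forall_pos_le_add fun ε hε => ?_ <;>
    obtain ⟨δ, hδ, hlt⟩ := key (ε / (frobSq X + 1)) (by positivity) <;>
    have h := hδ X hX <;>
    have h2 : ε / (frobSq X + 1) * frobSq X ≤ ε := by
      rw [div_mul_eq_mul_div, div_le_iff₀ (by positivity)]; nlinarith
  · nlinarith [h.1]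
  · nlinarith [h.2]

/-- The constraint `‖A^*(y - A(X))‖ ≤ lam` of the matrix Dantzig selector. -/
def DantzigFeasible {m n : ℕ} (A : Fin m → Matrix (Fin n) (Fin n) ℝ) (y : Fin m → ℝ) (lam : ℝ)
    (X : Matrix (Fin n) (Fin n) ℝ) : Prop :=
  opNorm (measAdj A (y - meas A X)) ≤ lam

/-- `X` solves the matrix Dantzig selector: it is feasible and has least nuclear norm among the
feasible matrices. -/
def IsDantzigSolution {m n : ℕ} (A : Fin m → Matrix (Fin n) (Fin n) ℝ) (y : Fin m → ℝ) (lam : ℝ)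
    (X : Matrix (Fin n) (Fin n) ℝ) : Prop :=
  DantzigFeasible A y lam X ∧
    ∀ X' : Matrix (Fin n) (Fin n) ℝ, DantzigFeasible A y lam X' → nuclearNorm X ≤ nuclearNorm X'

end LowRank

end

namespace LowRank

open Matrix

/-! The proof separates one probabilistic event from a deterministic oracle inequality. Write `Λ =
16 √n σ`, so that the constraint level is `2Λ`, and `θ = nσ²`, so that `Λ² = 256 θ`.

Noise: on an event of probability at least `1 - exp (-n)` the noise matrix satisfies `‖A^* z‖ ≤ Λ`.
This is a union bound over pairs from a norming set of at most `5 ^ n` points; isometry on rank-one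
matrices controls the variance of each bilinear form (`exists_event_opNorm_measAdj_le`). On this
event `M` is feasible, and compactness gives a solution.

Oracle: comparing the solution directly with `M` would give an error of order `rank(M) Λ²`. Instead
it is compared with a near minimiser `N` of `Λ²/3 · rank(X) + ‖A(X - M)‖²`
(`exists_penalized_approximation`). If the gradient `A^* A (N - M)` had norm above `Λ`, a rank-one
step would lower the functional too much; hence `N` is feasible. Testing the functional at the
truncation of `M` to singular values with `σ_i² > θ` bounds its value at `N` by a multiple of `∑
min(σ_i², θ)`.

Stability: a solution `X` has nuclear norm at most that of `N`, so `h = X - N` satisfies a cone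
condition, while `‖A^* A h‖ ≤ 4Λ` because both matrices are feasible. Splitting the tail of `h` into
blocks of singular values and using restricted orthogonality yields `‖h‖_F² ≲ rank(N) Λ²`
(`frobSq_le_of_nuclearNorm_le`). The isometry bounds `‖N - M‖_F²` by `‖A(N - M)‖²`, and both errors
are paid for by the functional. -/

/-! ### Singular value decomposition -/

/-- The matrix whose columns are the vectors of an orthonormal basis is orthogonal. -/
theorem transpose_mul_self_of_orthonormalBasis {n : ℕ}
    (b : OrthonormalBasis (Fin n) ℝ (EuclideanSpace ℝ (Fin n))) :
    (Matrix.of fun i j => b j i)ᵀ * (Matrix.of fun i j => b j i) = (1 : Matrix (Fin n) (Fin n) ℝ) := by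
  ext i j
  have h := b.inner_eq_ite i j
  simp only [PiLp.inner_apply, RCLike.inner_apply, conj_trivial] at h
  simp only [Matrix.mul_apply, Matrix.transpose_apply, Matrix.of_apply, Matrix.one_apply]
  rw [← h]
  exact Finset.sum_congr rfl fun _ _ => mul_comm _ _

/-- Singular value decomposition of a square real matrix. -/
theorem exists_svd {n : ℕ} (X : Matrix (Fin n) (Fin n) ℝ) :
    ∃ U V : Matrix (Fin n) (Fin n) ℝ, Uᵀ * U = 1 ∧ Vᵀ * V = 1 ∧
      X = U * diagonal (fun i : Fin n => singVal X i) * Vᵀ := by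
  set T := Matrix.toEuclideanLin X with hTdef
  have hn : Module.finrank ℝ (EuclideanSpace ℝ (Fin n)) = n := finrank_euclideanSpace_fin
  have hT := T.isSymmetric_adjoint_comp_self
  set b := hT.eigenvectorBasis hn
  have hs : ∀ i : Fin n, singVal X i ^ 2 = hT.eigenvalues hn i :=
    fun i => T.sq_singularValues_fin hn i
  have hin : ∀ i j : Fin n, inner ℝ (T (b i)) (T (b j)) = if i = j then singVal X i ^ 2 else 0 := by
    intro i j
    have h1 : (LinearMap.adjoint T ∘ₗ T) (b j) = (hT.eigenvalues hn j : ℝ) • b j :=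
      hT.apply_eigenvectorBasis hn j
    rw [← LinearMap.adjoint_inner_right, ← LinearMap.comp_apply, h1, inner_smul_right,
      b.inner_eq_ite, ← hs]
    split_ifs with h <;> simp [h]
  -- The images `T (b i)` are orthogonal with norms `singVal X i`; normalising gives left singular
  -- vectors. Where the singular value vanishes, `u i = 0` is a dummy, left out of the orthonormal
  -- family and replaced when the family is extended to a basis.
  let u : Fin n → EuclideanSpace ℝ (Fin n) := fun i => (singVal X i)⁻¹ • T (b i)
  have hu : Orthonormal ℝ (Set.domRestrict {i : Fin n | singVal X i ≠ 0} u) := by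
    rw [orthonormal_iff_ite]
    rintro ⟨i, hi⟩ ⟨j, hj⟩
    simp only [Set.mem_ofPred_eq] at hi hj
    simp only [Set.domRestrict_apply, u, inner_smul_left, inner_smul_right, hin, conj_trivial,
      Subtype.mk.injEq]
    split_ifs with h
    · subst h; field_simp
    · simp
  obtain ⟨c, hc⟩ := hu.exists_orthonormalBasis_extension_of_card_eq (by simp)
  have hTb : ∀ i, T (b i) = singVal X i • c i := by
    intro i
    by_cases h : singVal X i = 0
    · have := hin i i
      rw [if_pos rfl, h, real_inner_self_eq_norm_sq] at this
      simp at this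
      simp [h, this]
    · rw [hc i h]; simp [u, h]
  refine ⟨.of fun i j => c j i, .of fun i j => b j i, transpose_mul_self_of_orthonormalBasis c,
    transpose_mul_self_of_orthonormalBasis b, ?_⟩
  have hV := mul_eq_one_comm.1 (transpose_mul_self_of_orthonormalBasis b)
  have : X * (.of fun i j => b j i) = (.of fun i j => c j i) * diagonal (fun i : Fin n => singVal X i) := by
    ext i j
    have := congrArg (fun v : EuclideanSpace ℝ (Fin n) => v i) (hTb j)
    simp [hTdef, Matrix.toLpLin_apply, Matrix.mulVec, dotProduct] at this
    rw [Matrix.mul_diagonal, Matrix.mul_apply]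
    simp [this, mul_comm]
  rw [← this, Matrix.mul_assoc, hV, Matrix.mul_one]

/-! ### Frobenius inner product -/

/-- The Frobenius inner product. -/
def frobInner {n : ℕ} (X Y : Matrix (Fin n) (Fin n) ℝ) : ℝ := trace (Xᵀ * Y)

section frobInner

variable {n : ℕ} (X Y Z : Matrix (Fin n) (Fin n) ℝ)

theorem frobInner_add_left : frobInner (X + Y) Z = frobInner X Z + frobInner Y Z := by
  simp [frobInner, Matrix.add_mul]

theorem frobInner_add_right : frobInner X (Y + Z) = frobInner X Y + frobInner X Z := by
  simp [frobInner, Matrix.mul_add]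

theorem frobInner_smul_left (c : ℝ) : frobInner (c • X) Y = c * frobInner X Y := by
  simp [frobInner]

theorem frobInner_smul_right (c : ℝ) : frobInner X (c • Y) = c * frobInner X Y := by
  simp [frobInner]

theorem frobInner_neg_right : frobInner X (-Y) = -frobInner X Y := by
  simp [frobInner]

theorem frobInner_sum_right {ι : Type*} (s : Finset ι) (F : ι → Matrix (Fin n) (Fin n) ℝ) :
    frobInner X (∑ i ∈ s, F i) = ∑ i ∈ s, frobInner X (F i) := by
  simp [frobInner, Matrix.mul_sum]

theorem frobInner_sum_left {ι : Type*} (s : Finset ι) (F : ι → Matrix (Fin n) (Fin n) ℝ) :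
    frobInner (∑ i ∈ s, F i) X = ∑ i ∈ s, frobInner (F i) X := by
  simp [frobInner, Matrix.transpose_sum, Matrix.sum_mul]

theorem frobInner_comm : frobInner X Y = frobInner Y X := by
  rw [frobInner, ← trace_transpose, transpose_mul, transpose_transpose, frobInner]

theorem frobInner_mul_left : frobInner (X * Y) Z = frobInner Y (Xᵀ * Z) := by
  rw [frobInner, frobInner, transpose_mul, Matrix.mul_assoc]

theorem frobInner_mul_right : frobInner (X * Y) Z = frobInner X (Z * Yᵀ) := by
  rw [frobInner, frobInner, transpose_mul, Matrix.mul_assoc, trace_mul_comm, Matrix.mul_assoc]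

theorem frobInner_eq_sum : frobInner X Y = ∑ i, ∑ j, X i j * Y i j := by
  simp only [frobInner, Matrix.trace, Matrix.diag, Matrix.mul_apply, Matrix.transpose_apply]
  rw [Finset.sum_comm]

theorem frobInner_self : frobInner X X = frobSq X := by
  simp only [frobInner_eq_sum, frobSq, sq]

theorem frobSq_add : frobSq (X + Y) = frobSq X + 2 * frobInner X Y + frobSq Y := by
  rw [← frobInner_self, ← frobInner_self, ← frobInner_self, frobInner_add_left,
    frobInner_add_right, frobInner_add_right, frobInner_comm Y X]
  ring

theorem frobSq_smul (c : ℝ) : frobSq (c • X) = c ^ 2 * frobSq X := by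
  rw [← frobInner_self, ← frobInner_self, frobInner_smul_left, frobInner_smul_right]
  ring

theorem frobSq_eq_zero_iff : frobSq X = 0 ↔ X = 0 := by
  constructor
  · intro h
    ext i j
    have h1 := (Finset.sum_eq_zero_iff_of_nonneg
      (fun i _ => Finset.sum_nonneg fun j _ => sq_nonneg (X i j))).1 h i (Finset.mem_univ _)
    have h2 := (Finset.sum_eq_zero_iff_of_nonneg
      (fun j _ => sq_nonneg (X i j))).1 h1 j (Finset.mem_univ _)
    simpa using h2
  · rintro rfl
    simp [frobSq]

theorem frobInner_vecMulVec (u v : Fin n → ℝ) : frobInner (vecMulVec u v) X = u ⬝ᵥ X *ᵥ v := by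
  simp only [frobInner_eq_sum, vecMulVec_apply, dotProduct, mulVec, Finset.mul_sum]
  exact Finset.sum_congr rfl fun i _ => Finset.sum_congr rfl fun j _ => by ring

theorem frobSq_vecMulVec (u v : Fin n → ℝ) : frobSq (vecMulVec u v) = (u ⬝ᵥ u) * (v ⬝ᵥ v) := by
  simp only [frobSq, vecMulVec_apply, dotProduct, Finset.sum_mul_sum]
  exact Finset.sum_congr rfl fun i _ => Finset.sum_congr rfl fun j _ => by ring

end frobInner

/-! ### Operator norm and bilinear forms -/

section opNorm

variable {n : ℕ} (X Y : Matrix (Fin n) (Fin n) ℝ)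

theorem opNorm_nonneg : 0 ≤ opNorm X := norm_nonneg _

theorem opNorm_add_le : opNorm (X + Y) ≤ opNorm X + opNorm Y := by
  simpa [opNorm] using norm_add_le (toEuclideanCLM (n := Fin n) (𝕜 := ℝ) X) (toEuclideanCLM (n := Fin n) (𝕜 := ℝ) Y)

theorem opNorm_neg : opNorm (-X) = opNorm X := by
  simp [opNorm]

theorem opNorm_mul_le : opNorm (X * Y) ≤ opNorm X * opNorm Y := by
  simpa [opNorm] using norm_mul_le (toEuclideanCLM (n := Fin n) (𝕜 := ℝ) X) (toEuclideanCLM (n := Fin n) (𝕜 := ℝ) Y)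

theorem opNorm_transpose_mul_self : opNorm (Xᵀ * X) = opNorm X * opNorm X := by
  have : Xᵀ = star X := by
    rw [star_eq_conjTranspose, conjTranspose_eq_transpose_of_trivial]
  rw [this, opNorm, map_mul, map_star]
  exact CStarRing.norm_star_mul_self (x := toEuclideanCLM (n := Fin n) (𝕜 := ℝ) X)

variable {X} in
/-- An orthogonal projection is a contraction. -/
theorem opNorm_le_one_of_projection (h1 : Xᵀ = X) (h2 : X * X = X) : opNorm X ≤ 1 := by
  have := opNorm_transpose_mul_self X
  rw [h1, h2] at this
  nlinarith [opNorm_nonneg X]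

variable {X} in
theorem opNorm_le_one_of_transpose_mul_self (h1 : Xᵀ * X = 1) : opNorm X ≤ 1 := by
  have := opNorm_transpose_mul_self X
  rw [h1] at this
  have h2 := opNorm_le_one_of_projection (X := (1 : Matrix (Fin n) (Fin n) ℝ)) (by simp) (by simp)
  nlinarith [opNorm_nonneg X]

theorem dotProduct_mulVec_le (u v : Fin n → ℝ) :
    u ⬝ᵥ X *ᵥ v ≤ opNorm X * (√(u ⬝ᵥ u) * √(v ⬝ᵥ v)) := by
  have hn : ∀ w : Fin n → ℝ, √(w ⬝ᵥ w) = ‖(WithLp.toLp 2 w : EuclideanSpace ℝ (Fin n))‖ := by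
    intro w
    rw [EuclideanSpace.norm_eq]
    simp [dotProduct, sq]
  rw [hn, hn]
  have h := real_inner_le_norm (toEuclideanCLM (n := Fin n) (𝕜 := ℝ) X (WithLp.toLp 2 v)) (WithLp.toLp 2 u)
  have h' := (toEuclideanCLM (n := Fin n) (𝕜 := ℝ) X).le_opNorm (WithLp.toLp 2 v)
  rw [EuclideanSpace.inner_eq_star_dotProduct] at h
  simp at h
  refine h.trans ((mul_le_mul_of_nonneg_right h' (norm_nonneg _)).trans (le_of_eq ?_))
  rw [opNorm]; ring

variable {X} in
/-- The operator norm is bounded by any bound for the bilinear form. -/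
theorem opNorm_le_of_forall_dotProduct {c : ℝ} (hc : 0 ≤ c)
    (h : ∀ u v : Fin n → ℝ, u ⬝ᵥ u = 1 → v ⬝ᵥ v = 1 → u ⬝ᵥ X *ᵥ v ≤ c) : opNorm X ≤ c := by
  have h' : ∀ u v : Fin n → ℝ, u ⬝ᵥ X *ᵥ v ≤ c * (√(u ⬝ᵥ u) * √(v ⬝ᵥ v)) := by
    intro u v
    have hnn : ∀ w : Fin n → ℝ, 0 ≤ w ⬝ᵥ w := fun w =>
      Finset.sum_nonneg fun i _ => mul_self_nonneg _
    rcases (hnn u).eq_or_lt with hu | hu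
    · rw [dotProduct_self_eq_zero.1 hu.symm]; simp
    rcases (hnn v).eq_or_lt with hv | hv
    · rw [dotProduct_self_eq_zero.1 hv.symm]; simp
    have hu' := Real.sqrt_pos.2 hu
    have hv' := Real.sqrt_pos.2 hv
    have := h ((√(u ⬝ᵥ u))⁻¹ • u) ((√(v ⬝ᵥ v))⁻¹ • v)
      (by simp only [smul_dotProduct, dotProduct_smul, smul_eq_mul]
          field_simp
          rw [Real.sq_sqrt hu.le])
      (by simp only [smul_dotProduct, dotProduct_smul, smul_eq_mul]
          field_simp
          rw [Real.sq_sqrt hv.le])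
    simp only [mulVec_smul, smul_dotProduct, dotProduct_smul, smul_eq_mul] at this
    field_simp at this
    linarith
  have hn : ∀ w : EuclideanSpace ℝ (Fin n), √(w.ofLp ⬝ᵥ w.ofLp) = ‖w‖ := by
    intro w
    rw [EuclideanSpace.norm_eq]
    simp [dotProduct, sq]
  refine ContinuousLinearMap.opNorm_le_bound _ hc fun v => ?_
  set w := toEuclideanCLM (n := Fin n) (𝕜 := ℝ) X v with hw
  have h1 := h' w.ofLp v.ofLp
  have h2 : w.ofLp ⬝ᵥ X *ᵥ v.ofLp = ‖w‖ ^ 2 := by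
    rw [← hn, Real.sq_sqrt (show 0 ≤ w.ofLp ⬝ᵥ w.ofLp from
      Finset.sum_nonneg fun i _ => mul_self_nonneg _)]
    rw [hw, ofLp_toEuclideanCLM]
  rw [h2, hn, hn] at h1
  rcases (norm_nonneg w).eq_or_lt with h0 | h0
  · rw [← h0]; positivity
  · have : ‖w‖ * ‖w‖ ≤ ‖w‖ * (c * ‖v‖) := by nlinarith
    exact le_of_mul_le_mul_left this h0

end opNorm

/-! ### Nuclear norm: duality and comparison with the Frobenius norm -/

section svd

variable {n : ℕ} {U V : Matrix (Fin n) (Fin n) ℝ}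

theorem frobSq_mul_diagonal_mul (hU : Uᵀ * U = 1) (hV : Vᵀ * V = 1) (s : Fin n → ℝ) :
    frobSq (U * diagonal s * Vᵀ) = ∑ i, s i ^ 2 := by
  rw [← frobInner_self, frobInner_mul_right, transpose_transpose, Matrix.mul_assoc, hV,
    Matrix.mul_one, frobInner_mul_left, ← Matrix.mul_assoc, hU, Matrix.one_mul]
  simp [frobInner, sq]

theorem rank_mul_diagonal_mul (hU : Uᵀ * U = 1) (hV : Vᵀ * V = 1) (s : Fin n → ℝ) :
    (U * diagonal s * Vᵀ).rank = (Finset.univ.filter fun i => s i ≠ 0).card := by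
  have hU' : IsUnit U.det := isUnit_det_of_left_inverse hU
  have hV' : IsUnit Vᵀ.det := isUnit_det_of_right_inverse hV
  rw [rank_mul_eq_left_of_isUnit_det _ _ hV', rank_mul_eq_right_of_isUnit_det _ _ hU',
    rank_diagonal, Fintype.card_subtype]

/-- Moving `U` and `V` to the other side leaves only the diagonal entries of `Uᵀ W V`, which are
values of the bilinear form of `W` at unit vectors. -/
theorem frobInner_mul_diagonal_mul_le (hU : Uᵀ * U = 1) (hV : Vᵀ * V = 1) (s : Fin n → ℝ)
    (W : Matrix (Fin n) (Fin n) ℝ) :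
    frobInner (U * diagonal s * Vᵀ) W ≤ (∑ i, |s i|) * opNorm W := by
  rw [frobInner_mul_right, transpose_transpose, frobInner_mul_left, Finset.sum_mul]
  have h1 : frobInner (diagonal s) (Uᵀ * (W * V)) = ∑ i, s i * (Uᵀ * (W * V)) i i := by
    simp [frobInner, Matrix.trace]
  rw [h1]
  refine Finset.sum_le_sum fun i _ => ?_
  have h2 : (Uᵀ * (W * V)) i i = (fun k => U k i) ⬝ᵥ W *ᵥ (fun k => V k i) := by
    simp [Matrix.mul_apply, dotProduct, mulVec]
  have hcol : ∀ O : Matrix (Fin n) (Fin n) ℝ, Oᵀ * O = 1 → (fun k => O k i) ⬝ᵥ (fun k => O k i) = 1 := by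
    intro O hO
    simpa [Matrix.mul_apply, dotProduct] using congrFun (congrFun hO i) i
  have h3 : |(Uᵀ * (W * V)) i i| ≤ opNorm W := by
    rw [h2, abs_le]
    have ha := dotProduct_mulVec_le W (fun k => U k i) (fun k => V k i)
    have hb := dotProduct_mulVec_le (-W) (fun k => U k i) (fun k => V k i)
    rw [hcol U hU, hcol V hV] at ha hb
    rw [neg_mulVec, dotProduct_neg, opNorm_neg] at hb
    simp only [Real.sqrt_one, mul_one] at ha hb
    constructor <;> linarith
  calc s i * (Uᵀ * (W * V)) i i ≤ |s i * (Uᵀ * (W * V)) i i| := le_abs_self _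
    _ ≤ _ := by rw [abs_mul]; gcongr

theorem frobInner_mul_diagonal_mul_self (hU : Uᵀ * U = 1) (hV : Vᵀ * V = 1) (s : Fin n → ℝ) :
    frobInner (U * diagonal s * Vᵀ) (U * Vᵀ) = ∑ i, s i := by
  rw [frobInner_mul_right, transpose_transpose, Matrix.mul_assoc, hV,
    Matrix.mul_one, frobInner_mul_left, hU]
  simp [frobInner]

theorem opNorm_mul_transpose_le_one (hU : Uᵀ * U = 1) (hV : Vᵀ * V = 1) : opNorm (U * Vᵀ) ≤ 1 := by
  refine opNorm_le_one_of_transpose_mul_self ?_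
  rw [transpose_mul, transpose_transpose, Matrix.mul_assoc, ← Matrix.mul_assoc Uᵀ, hU,
    Matrix.one_mul, mul_eq_one_comm.1 hV]

end svd

section nuclearNorm

variable {n : ℕ} (X Y : Matrix (Fin n) (Fin n) ℝ)

theorem singVal_nonneg (i : ℕ) : 0 ≤ singVal X i := LinearMap.singularValues_nonneg _ _

theorem singVal_antitone : Antitone (singVal X) := LinearMap.singularValues_antitone _

theorem nuclearNorm_eq_sum_fin : nuclearNorm X = ∑ i : Fin n, singVal X i :=
  Finset.sum_range _

theorem nuclearNorm_nonneg : 0 ≤ nuclearNorm X := Finset.sum_nonneg fun i _ => singVal_nonneg X i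

theorem frobSq_eq_sum_singVal : frobSq X = ∑ i : Fin n, singVal X i ^ 2 := by
  obtain ⟨U, V, hU, hV, h⟩ := exists_svd X
  conv_lhs => rw [h]
  rw [frobSq_mul_diagonal_mul hU hV]

theorem rank_eq_card_singVal :
    X.rank = (Finset.univ.filter fun i : Fin n => singVal X i ≠ 0).card := by
  obtain ⟨U, V, hU, hV, h⟩ := exists_svd X
  conv_lhs => rw [h]
  rw [rank_mul_diagonal_mul hU hV]

/-- Duality between the nuclear norm and the operator norm. -/
theorem frobInner_le_nuclearNorm_mul_opNorm (W : Matrix (Fin n) (Fin n) ℝ) :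
    frobInner X W ≤ nuclearNorm X * opNorm W := by
  obtain ⟨U, V, hU, hV, h⟩ := exists_svd X
  have := frobInner_mul_diagonal_mul_le hU hV (fun i : Fin n => singVal X i) W
  rw [← h] at this
  simpa [nuclearNorm_eq_sum_fin, abs_of_nonneg (singVal_nonneg X _)] using this

/-- The certificate is the orthogonal matrix `U * Vᵀ` built from the singular vectors. With the
duality inequality this makes the nuclear norm a maximum of linear functionals, whence its triangle
inequality and the cone condition. -/
theorem exists_frobInner_eq_nuclearNorm :
    ∃ W : Matrix (Fin n) (Fin n) ℝ, opNorm W ≤ 1 ∧ frobInner X W = nuclearNorm X := by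
  obtain ⟨U, V, hU, hV, h⟩ := exists_svd X
  refine ⟨U * Vᵀ, opNorm_mul_transpose_le_one hU hV, ?_⟩
  have := frobInner_mul_diagonal_mul_self hU hV (fun i : Fin n => singVal X i)
  rw [← h] at this
  rw [this, nuclearNorm_eq_sum_fin]

/-- Cauchy–Schwarz over the nonzero singular values, of which there are `X.rank`. -/
theorem nuclearNorm_sq_le : nuclearNorm X ^ 2 ≤ X.rank * frobSq X := by
  rw [frobSq_eq_sum_singVal, rank_eq_card_singVal, nuclearNorm_eq_sum_fin]
  have h1 : ∑ i : Fin n, singVal X i =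
      ∑ i ∈ Finset.univ.filter (fun i : Fin n => singVal X i ≠ 0), singVal X i :=
    (Finset.sum_filter_ne_zero _).symm
  rw [h1]
  refine sq_sum_le_card_mul_sum_sq.trans ?_
  gcongr
  exact Finset.filter_subset _ _

theorem frobSq_le_nuclearNorm_sq : frobSq X ≤ nuclearNorm X ^ 2 := by
  rw [frobSq_eq_sum_singVal, nuclearNorm_eq_sum_fin]
  exact Finset.sum_sq_le_sq_sum_of_nonneg fun i _ => singVal_nonneg X i

end nuclearNorm

/-! ### Rank inequalities and blocks of singular values -/

theorem matrix_rank_add_le {n : ℕ} (X Y : Matrix (Fin n) (Fin n) ℝ) :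
    (X + Y).rank ≤ X.rank + Y.rank := by
  rw [Matrix.rank, Matrix.rank, Matrix.rank, mulVecLin_add]
  refine (Submodule.finrank_mono (LinearMap.range_add_le _ _)).trans ?_
  exact Submodule.finrank_add_le_finrank_add_finrank _ _

theorem rank_smul_le {n : ℕ} (c : ℝ) (X : Matrix (Fin n) (Fin n) ℝ) : (c • X).rank ≤ X.rank := by
  have := rank_mul_le_right (c • (1 : Matrix (Fin n) (Fin n) ℝ)) X
  simpa using this

theorem matrix_rank_neg {n : ℕ} (X : Matrix (Fin n) (Fin n) ℝ) : (-X).rank = X.rank := by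
  refine le_antisymm ?_ ?_
  · simpa using rank_smul_le (-1) X
  · simpa using rank_smul_le (-1) (-X)

theorem matrix_rank_sub_le {n : ℕ} (X Y : Matrix (Fin n) (Fin n) ℝ) :
    (X - Y).rank ≤ X.rank + Y.rank := by
  rw [sub_eq_add_neg, ← matrix_rank_neg Y]
  exact matrix_rank_add_le _ _

theorem sum_range_mul_eq (f : ℕ → ℝ) (q k : ℕ) :
    ∑ j ∈ Finset.range k, ∑ l ∈ Finset.range q, f (q * j + l) = ∑ i ∈ Finset.range (q * k), f i := by
  induction k with
  | zero => simp
  | succ k ih => rw [Finset.sum_range_succ, ih, Nat.mul_succ, Finset.sum_range_add]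

theorem singVal_of_le {n : ℕ} (X : Matrix (Fin n) (Fin n) ℝ) {i : ℕ} (h : n ≤ i) :
    singVal X i = 0 :=
  LinearMap.singularValues_of_finrank_le _ (by simpa using h)

theorem frobInner_mul_diagonal_mul {n : ℕ} {U V : Matrix (Fin n) (Fin n) ℝ} (hU : Uᵀ * U = 1)
    (hV : Vᵀ * V = 1) (s t : Fin n → ℝ) :
    frobInner (U * diagonal s * Vᵀ) (U * diagonal t * Vᵀ) = ∑ i, s i * t i := by
  rw [frobInner_mul_right, transpose_transpose, Matrix.mul_assoc, hV,
    Matrix.mul_one, frobInner_mul_left, ← Matrix.mul_assoc, hU, Matrix.one_mul]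
  simp [frobInner]

/-- The blocks of length `q` of a singular value decomposition. -/
theorem exists_block_decomposition {n : ℕ} (X : Matrix (Fin n) (Fin n) ℝ) {q : ℕ} (hq : 1 ≤ q) :
    ∃ H : ℕ → Matrix (Fin n) (Fin n) ℝ, X = ∑ j ∈ Finset.range (n + 1), H j ∧
      (∀ j, (H j).rank ≤ q) ∧ (∀ j, ∃ L, H j = L * X) ∧ (∀ j, ∃ R, H j = X * R) ∧
      (∀ i j, i ≠ j → frobInner (H i) (H j) = 0) ∧
      (∑ j ∈ Finset.range n, √(frobSq (H (j + 1)))) * √q ≤ nuclearNorm X := by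
  obtain ⟨U, V, hU, hV, hX⟩ := exists_svd X
  -- Indicator of the `j`-th block of `q` consecutive indices. Blocks `0, …, n` cover all indices
  -- for every `q ≥ 1`; superfluous ones are zero.
  let e : ℕ → Fin n → ℝ := fun j i => if (i : ℕ) / q = j then 1 else 0
  let s : Fin n → ℝ := fun i => singVal X i
  have hq0 : 0 < q := hq
  have hcard : ∀ j, (Finset.univ.filter fun i : Fin n => (i : ℕ) / q = j).card ≤ q := by
    intro j
    have : (Finset.univ.filter fun i : Fin n => (i : ℕ) / q = j).card ≤
        (Finset.Ico (q * j) (q * j + q)).card := by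
      refine Finset.card_le_card_of_injOn (fun i => (i : ℕ)) ?_ (Fin.val_injective.injOn)
      intro i hi
      have hi' : (i : ℕ) / q = j := by simpa using hi
      simp only [Finset.coe_Ico, Set.mem_Ico]
      subst hi'
      exact ⟨Nat.mul_div_le _ _, by rw [← Nat.mul_succ]; exact Nat.lt_mul_div_succ _ hq0⟩
    simpa using this
  refine ⟨fun j => U * diagonal (fun i => e j i * s i) * Vᵀ, ?_, ?_, ?_, ?_, ?_, ?_⟩
  · rw [← Finset.sum_mul, ← Finset.mul_sum, hX]
    congr 2
    ext i k
    rw [Matrix.sum_apply]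
    by_cases hik : i = k
    · subst hik
      have hlt : (i : ℕ) / q < n + 1 := (Nat.div_le_self _ _).trans_lt (i.2.trans (Nat.lt_succ_self n))
      simp [e, s, Finset.sum_ite_eq, hlt]
    · simp [hik]
  · intro j
    rw [rank_mul_diagonal_mul hU hV]
    refine (Finset.card_le_card ?_).trans (hcard j)
    intro i hi
    by_contra hc
    simp only [Finset.mem_filter, Finset.mem_univ, true_and] at hi hc
    exact hi (by simp [e, hc])
  · intro j
    refine ⟨U * diagonal (e j) * Uᵀ, ?_⟩
    conv_rhs => rw [hX]
    calc _ = U * (diagonal (e j) * diagonal s) * Vᵀ := by rw [diagonal_mul_diagonal]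
      _ = U * diagonal (e j) * (Uᵀ * U) * diagonal s * Vᵀ := by
        rw [hU]; simp only [Matrix.mul_assoc, Matrix.one_mul]
      _ = _ := by simp only [Matrix.mul_assoc, s]
  · intro j
    refine ⟨V * diagonal (e j) * Vᵀ, ?_⟩
    conv_rhs => rw [hX]
    calc _ = U * (diagonal s * diagonal (e j)) * Vᵀ := by
          rw [diagonal_mul_diagonal]; simp only [mul_comm]
      _ = U * diagonal s * (Vᵀ * V) * diagonal (e j) * Vᵀ := by
        rw [hV]; simp only [Matrix.mul_assoc, Matrix.one_mul]
      _ = _ := by simp only [Matrix.mul_assoc, s]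
  · intro i j hij
    rw [frobInner_mul_diagonal_mul hU hV]
    refine Finset.sum_eq_zero fun k _ => ?_
    simp only [e]
    split_ifs with h1 h2 <;> simp_all
  · have hsq : (0 : ℝ) < √q := Real.sqrt_pos.2 (by exact_mod_cast hq0)
    have hqq : √(q : ℝ) * √q = q := Real.mul_self_sqrt (by positivity)
    have hqR : (0 : ℝ) < q := by exact_mod_cast hq0
    -- By monotonicity each singular value in block `j + 1` is at most the average `N / q` of block
    -- `j`, so block `j + 1` has Frobenius norm at most `N / √q`.
    have hb : ∀ j, √(frobSq (U * diagonal (fun i => e (j + 1) i * s i) * Vᵀ)) * √q ≤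
        ∑ l ∈ Finset.range q, singVal X (q * j + l) := by
      intro j
      set N := ∑ l ∈ Finset.range q, singVal X (q * j + l)
      have hN : 0 ≤ N := Finset.sum_nonneg fun l _ => singVal_nonneg X _
      have h1 : ∀ i : Fin n, (i : ℕ) / q = j + 1 → q * s i ≤ N := by
        intro i hi
        have : (Finset.range q).card • s i ≤ N := by
          refine Finset.card_nsmul_le_sum _ _ _ fun l hl => singVal_antitone X ?_
          have : q * ((i : ℕ) / q) ≤ i := Nat.mul_div_le _ _
          rw [hi] at this
          have hl := Finset.mem_range.1 hl
          nlinarith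
        simpa using this
      have h2 : frobSq (U * diagonal (fun i => e (j + 1) i * s i) * Vᵀ) ≤ N ^ 2 / q := by
        rw [frobSq_mul_diagonal_mul hU hV]
        calc ∑ i, (e (j + 1) i * s i) ^ 2
            = ∑ i ∈ Finset.univ.filter (fun i : Fin n => (i : ℕ) / q = j + 1), s i ^ 2 := by
              rw [Finset.sum_filter]
              refine Finset.sum_congr rfl fun i _ => ?_
              simp only [e]
              split_ifs <;> simp
          _ ≤ (Finset.univ.filter (fun i : Fin n => (i : ℕ) / q = j + 1)).card • (N / q) ^ 2 := by
              refine Finset.sum_le_card_nsmul _ _ _ fun i hi => ?_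
              have := h1 i (Finset.mem_filter.1 hi).2
              refine pow_le_pow_left₀ (singVal_nonneg X _) ?_ 2
              rw [le_div_iff₀ hqR]; linarith
          _ ≤ q * (N / q) ^ 2 := by
              rw [nsmul_eq_mul]
              gcongr
              exact hcard _
          _ = N ^ 2 / q := by field_simp
      calc _ ≤ √(N ^ 2 / q) * √q := by gcongr
        _ = N := by
          rw [Real.sqrt_div (sq_nonneg _), Real.sqrt_sq hN]; field_simp
    rw [Finset.sum_mul]
    refine (Finset.sum_le_sum fun j _ => hb j).trans ?_
    rw [sum_range_mul_eq, nuclearNorm]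
    refine le_of_eq (Finset.sum_subset ?_ ?_).symm
    · exact Finset.range_subset_range.2 (Nat.le_mul_of_pos_left _ hq0)
    · intro i _ hi
      exact singVal_of_le X (by simpa using hi)

/-! ### Projections, pinching and the cone condition -/

theorem frobInner_mul_mul_right {n : ℕ} (X P W Q : Matrix (Fin n) (Fin n) ℝ) (hP : Pᵀ = P)
    (hQ : Qᵀ = Q) : frobInner X (P * W * Q) = frobInner (P * X * Q) W := by
  rw [frobInner_mul_right, frobInner_mul_left, hP, hQ, Matrix.mul_assoc]

/-- Projections onto the column space and the row space of a matrix. -/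
theorem exists_projections {n : ℕ} (M : Matrix (Fin n) (Fin n) ℝ) :
    ∃ P Q : Matrix (Fin n) (Fin n) ℝ, Pᵀ = P ∧ P * P = P ∧ Qᵀ = Q ∧ Q * Q = Q ∧
      P * M = M ∧ M * Q = M ∧ P.rank ≤ M.rank ∧ Q.rank ≤ M.rank := by
  obtain ⟨U, V, hU, hV, hM⟩ := exists_svd M
  let s : Fin n → ℝ := fun i => singVal M i
  -- Indicator of the nonzero singular values: the projections are onto the spans of the
  -- corresponding left and right singular vectors.
  let e : Fin n → ℝ := fun i => if s i = 0 then 0 else 1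
  have hee : diagonal e * diagonal e = diagonal e := by
    rw [diagonal_mul_diagonal]
    congr 1; ext i; simp [e]
  have hes : diagonal e * diagonal s = diagonal s := by
    rw [diagonal_mul_diagonal]
    congr 1; ext i; simp only [e]; split_ifs with h <;> simp [h]
  have hse : diagonal s * diagonal e = diagonal s := by
    rw [diagonal_mul_diagonal]
    congr 1; ext i; simp only [e]; split_ifs with h <;> simp [h]
  have hproj : ∀ O : Matrix (Fin n) (Fin n) ℝ, Oᵀ * O = 1 →
      (O * diagonal e * Oᵀ)ᵀ = O * diagonal e * Oᵀ ∧
      (O * diagonal e * Oᵀ) * (O * diagonal e * Oᵀ) = O * diagonal e * Oᵀ ∧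
      (O * diagonal e * Oᵀ).rank ≤ M.rank := by
    intro O hO
    refine ⟨by simp [transpose_mul, Matrix.mul_assoc], ?_, ?_⟩
    · calc _ = O * diagonal e * (Oᵀ * O) * diagonal e * Oᵀ := by simp only [Matrix.mul_assoc]
        _ = O * (diagonal e * diagonal e) * Oᵀ := by
          rw [hO]; simp only [Matrix.mul_assoc, Matrix.one_mul]
        _ = _ := by rw [hee]
    · rw [rank_mul_diagonal_mul hO hO, rank_eq_card_singVal]
      refine Finset.card_le_card fun i hi => ?_
      simpa [e, s] using hi
  refine ⟨U * diagonal e * Uᵀ, V * diagonal e * Vᵀ, (hproj U hU).1, (hproj U hU).2.1,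
    (hproj V hV).1, (hproj V hV).2.1, ?_, ?_, (hproj U hU).2.2, (hproj V hV).2.2⟩
  · calc _ = U * diagonal e * (Uᵀ * U) * diagonal s * Vᵀ := by
          conv_lhs => rw [hM]
          simp only [Matrix.mul_assoc, s]
      _ = U * (diagonal e * diagonal s) * Vᵀ := by
          rw [hU]; simp only [Matrix.mul_assoc, Matrix.one_mul]
      _ = M := by rw [hes]; exact hM.symm
  · calc _ = U * diagonal s * (Vᵀ * V) * diagonal e * Vᵀ := by
          conv_lhs => rw [hM]
          simp only [Matrix.mul_assoc, s]
      _ = U * (diagonal s * diagonal e) * Vᵀ := by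
          rw [hV]; simp only [Matrix.mul_assoc, Matrix.one_mul]
      _ = M := by rw [hse]; exact hM.symm

theorem dotProduct_proj_add {n : ℕ} {P : Matrix (Fin n) (Fin n) ℝ} (hP : Pᵀ = P) (hPP : P * P = P)
    (u : Fin n → ℝ) :
    (P *ᵥ u) ⬝ᵥ (P *ᵥ u) + ((1 - P) *ᵥ u) ⬝ᵥ ((1 - P) *ᵥ u) = u ⬝ᵥ u := by
  have h : (P *ᵥ u) ⬝ᵥ (P *ᵥ u) = u ⬝ᵥ P *ᵥ u := by
    rw [dotProduct_mulVec, vecMul_mulVec, hP, hPP, ← dotProduct_mulVec, dotProduct_comm,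
      ← hP, mulVec_transpose, ← dotProduct_mulVec]
  simp only [sub_mulVec, one_mulVec, dotProduct_sub, sub_dotProduct, h]
  rw [dotProduct_comm (P *ᵥ u) u]
  ring

/-- Pinching: two contractions acting between complementary subspaces form a contraction. -/
theorem opNorm_pinching_le_one {n : ℕ} {P Q W₁ W₂ : Matrix (Fin n) (Fin n) ℝ} (hP : Pᵀ = P)
    (hPP : P * P = P) (hQ : Qᵀ = Q) (hQQ : Q * Q = Q) (h₁ : opNorm W₁ ≤ 1) (h₂ : opNorm W₂ ≤ 1) :
    opNorm (P * W₁ * Q + (1 - P) * W₂ * (1 - Q)) ≤ 1 := by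
  refine opNorm_le_of_forall_dotProduct zero_le_one fun u v hu hv => ?_
  have hP' : (1 - P)ᵀ = 1 - P := by simp [hP]
  have key : ∀ R W S : Matrix (Fin n) (Fin n) ℝ, Rᵀ = R → opNorm W ≤ 1 →
      u ⬝ᵥ (R * W * S) *ᵥ v ≤ √((R *ᵥ u) ⬝ᵥ (R *ᵥ u)) * √((S *ᵥ v) ⬝ᵥ (S *ᵥ v)) := by
    intro R W S hR hW
    have : u ⬝ᵥ (R * W * S) *ᵥ v = (R *ᵥ u) ⬝ᵥ W *ᵥ (S *ᵥ v) := by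
      rw [mulVec_mulVec, Matrix.mul_assoc, ← mulVec_mulVec, dotProduct_mulVec, ← mulVec_transpose, hR]
    rw [this]
    refine (dotProduct_mulVec_le _ _ _).trans ?_
    exact mul_le_of_le_one_left (by positivity) hW
  rw [add_mulVec, dotProduct_add]
  have k1 := key P W₁ Q hP h₁
  have k2 := key (1 - P) W₂ (1 - Q) hP' h₂
  have e1 := dotProduct_proj_add hP hPP u
  have e2 := dotProduct_proj_add hQ hQQ v
  have hnn : ∀ w : Fin n → ℝ, 0 ≤ w ⬝ᵥ w := fun w =>
    Finset.sum_nonneg fun i _ => mul_self_nonneg _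
  have s1 := Real.sq_sqrt (hnn (P *ᵥ u))
  have s2 := Real.sq_sqrt (hnn ((1 - P) *ᵥ u))
  have s3 := Real.sq_sqrt (hnn (Q *ᵥ v))
  have s4 := Real.sq_sqrt (hnn ((1 - Q) *ᵥ v))
  rw [hu] at e1
  rw [hv] at e2
  set a := √((P *ᵥ u) ⬝ᵥ (P *ᵥ u))
  set b := √(((1 - P) *ᵥ u) ⬝ᵥ ((1 - P) *ᵥ u))
  set c := √((Q *ᵥ v) ⬝ᵥ (Q *ᵥ v))
  set d := √(((1 - Q) *ᵥ v) ⬝ᵥ ((1 - Q) *ᵥ v))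
  -- The form is at most `a c + b d ≤ (a² + b² + c² + d²) / 2 = 1`.
  nlinarith [sq_nonneg (a - c), sq_nonneg (b - d)]

/-- The cone condition satisfied by a perturbation that does not increase the nuclear norm. -/
theorem exists_cone_decomposition {n : ℕ} (M h : Matrix (Fin n) (Fin n) ℝ)
    (hle : nuclearNorm (M + h) ≤ nuclearNorm M) :
    ∃ h₀ h₁ : Matrix (Fin n) (Fin n) ℝ, h = h₀ + h₁ ∧ h₀.rank ≤ 2 * M.rank ∧
      nuclearNorm h₁ ≤ nuclearNorm h₀ ∧
      ∀ Y L R, Y = L * h₁ → Y = h₁ * R → frobInner h₀ Y = 0 := by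
  obtain ⟨P, Q, hP, hPP, hQ, hQQ, hPM, hMQ, hrP, hrQ⟩ := exists_projections M
  have hP' : (1 - P)ᵀ = 1 - P := by simp [hP]
  have hQ' : (1 - Q)ᵀ = 1 - Q := by simp [hQ]
  have hPP' : P * (1 - P) = 0 := by simp [Matrix.mul_sub, hPP]
  have hQQ' : (1 - Q) * Q = 0 := by simp [Matrix.sub_mul, hQQ]
  have hP'M : (1 - P) * M = 0 := by simp [Matrix.sub_mul, hPM]
  -- `h₁` is the part of `h` whose column and row spaces are orthogonal to those of `M`; the
  -- remainder `h₀` is a sum of one term with factor `P` and one with factor `Q`, hence of rank at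
  -- most twice that of `M`.
  set h₁ := (1 - P) * h * (1 - Q) with hh₁
  set h₀ := P * h + (1 - P) * h * Q with hh₀
  have hsum : h = h₀ + h₁ := by
    rw [hh₀, hh₁]; noncomm_ring
  have hPh₁ : P * h₁ = 0 := by
    rw [hh₁, ← Matrix.mul_assoc, ← Matrix.mul_assoc, hPP']; simp
  have hh₁Q : h₁ * Q = 0 := by
    rw [hh₁, Matrix.mul_assoc, hQQ']; simp
  refine ⟨h₀, h₁, hsum, ?_, ?_, ?_⟩
  · refine (matrix_rank_add_le _ _).trans ?_
    have r1 := rank_mul_le_left P h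
    have r2 := rank_mul_le_right ((1 - P) * h) Q
    omega
  · obtain ⟨W₁, hW₁, e₁⟩ := exists_frobInner_eq_nuclearNorm M
    obtain ⟨W₂, hW₂, e₂⟩ := exists_frobInner_eq_nuclearNorm h₁
    -- Pairing the pinched certificate with `M + h` gives `‖M‖_* + ‖h₁‖_*` plus a term at least
    -- `-‖h₀‖_*`; its norm being at most one, the pairing is at most `‖M + h‖_* ≤ ‖M‖_*`.
    have hW := opNorm_pinching_le_one hP hPP hQ hQQ hW₁ hW₂
    have k1 := frobInner_le_nuclearNorm_mul_opNorm (M + h) (P * W₁ * Q + (1 - P) * W₂ * (1 - Q))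
    have k2 := mul_le_of_le_one_right (nuclearNorm_nonneg (M + h)) hW
    have hPWQ : opNorm (-(P * W₁ * Q)) ≤ 1 := by
      rw [opNorm_neg]
      have p1 := opNorm_mul_le (P * W₁) Q
      have p2 := opNorm_mul_le P W₁
      have p3 := opNorm_le_one_of_projection hP hPP
      have p4 := opNorm_le_one_of_projection hQ hQQ
      have p5 := mul_le_one₀ p3 (opNorm_nonneg _) hW₁
      exact p1.trans (mul_le_one₀ (p2.trans p5) (opNorm_nonneg _) p4)
    have k3 := frobInner_le_nuclearNorm_mul_opNorm h₀ (-(P * W₁ * Q))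
    have k4 := mul_le_of_le_one_right (nuclearNorm_nonneg h₀) hPWQ
    rw [frobInner_neg_right] at k3
    have z1 : frobInner M (P * W₁ * Q) = nuclearNorm M := by
      rw [frobInner_mul_mul_right _ _ _ _ hP hQ, hPM, hMQ, e₁]
    have z2 : frobInner M ((1 - P) * W₂ * (1 - Q)) = 0 := by
      rw [frobInner_mul_mul_right _ _ _ _ hP' hQ', hP'M]; simp [frobInner]
    have z3 : frobInner h (P * W₁ * Q) = frobInner h₀ (P * W₁ * Q) := by
      have : frobInner h₁ (P * W₁ * Q) = 0 := by
        rw [frobInner_mul_mul_right _ _ _ _ hP hQ, hPh₁]; simp [frobInner]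
      conv_lhs => rw [hsum]
      rw [frobInner_add_left, this, add_zero]
    have z4 : frobInner h ((1 - P) * W₂ * (1 - Q)) = nuclearNorm h₁ := by
      rw [frobInner_mul_mul_right _ _ _ _ hP' hQ', ← hh₁, e₂]
    rw [frobInner_add_left, frobInner_add_right, frobInner_add_right, z1, z2, z3, z4] at k1
    linarith
  · intro Y L R hL hR
    -- The two factorisations let `Y` inherit the column and row spaces of `h₁`, so each term of
    -- `h₀` is orthogonal to it.
    have y1 : P * Y = 0 := by rw [hR, ← Matrix.mul_assoc, hPh₁, Matrix.zero_mul]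
    have y2 : Y * Q = 0 := by rw [hL, Matrix.mul_assoc, hh₁Q, Matrix.mul_zero]
    rw [hh₀, frobInner_add_left, frobInner_mul_left, frobInner_mul_right, hP, hQ, y1, y2]
    simp [frobInner]

/-! ### Gram operator and restricted isometry -/

/-- The operator `X ↦ A^* (A X)`. -/
def gram {m n : ℕ} (A : Fin m → Matrix (Fin n) (Fin n) ℝ) (X : Matrix (Fin n) (Fin n) ℝ) :
    Matrix (Fin n) (Fin n) ℝ := measAdj A (meas A X)

section gram

variable {m n : ℕ} (A : Fin m → Matrix (Fin n) (Fin n) ℝ) (X Y : Matrix (Fin n) (Fin n) ℝ)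

theorem meas_add : meas A (X + Y) = meas A X + meas A Y := by
  ext i; simp [meas, Matrix.mul_add]

theorem meas_sub : meas A (X - Y) = meas A X - meas A Y := by
  ext i; simp [meas, Matrix.mul_sub]

theorem meas_smul (c : ℝ) : meas A (c • X) = c • meas A X := by
  ext i; simp [meas]

theorem measAdj_add (v w : Fin m → ℝ) : measAdj A (v + w) = measAdj A v + measAdj A w := by
  simp [measAdj, add_smul, Finset.sum_add_distrib]

theorem measAdj_sub (v w : Fin m → ℝ) : measAdj A (v - w) = measAdj A v - measAdj A w := by
  simp [measAdj, sub_smul, Finset.sum_sub_distrib]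

theorem frobInner_measAdj (v : Fin m → ℝ) : frobInner (measAdj A v) X = ∑ i, v i * meas A X i := by
  rw [measAdj, frobInner_sum_left]
  exact Finset.sum_congr rfl fun i _ => frobInner_smul_left _ _ _

theorem gram_add : gram A (X + Y) = gram A X + gram A Y := by
  rw [gram, meas_add, measAdj_add, gram, gram]

theorem frobInner_gram_self : frobInner (gram A X) X = ∑ i, meas A X i ^ 2 := by
  rw [gram, frobInner_measAdj]
  exact Finset.sum_congr rfl fun i _ => (sq _).symm

theorem frobInner_gram_comm : frobInner (gram A X) Y = frobInner (gram A Y) X := by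
  rw [gram, gram, frobInner_measAdj, frobInner_measAdj]
  exact Finset.sum_congr rfl fun i _ => mul_comm _ _

theorem sum_meas_add_sq : ∑ i, meas A (X + Y) i ^ 2 =
    ∑ i, meas A X i ^ 2 + 2 * frobInner (gram A X) Y + ∑ i, meas A Y i ^ 2 := by
  simp only [← frobInner_gram_self, gram_add, frobInner_add_left, frobInner_add_right]
  rw [frobInner_gram_comm A Y X]
  ring

end gram

theorem RestrictedIsometry.mono {m n k l : ℕ} {A : Fin m → Matrix (Fin n) (Fin n) ℝ} {δ ε : ℝ}
    (h : RestrictedIsometry A k δ) (hlk : l ≤ k) (hδ : δ ≤ ε) : RestrictedIsometry A l ε := by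
  intro X hX
  obtain ⟨h1, h2⟩ := h X (hX.trans hlk)
  have := frobSq_nonneg X
  constructor <;> nlinarith

/-- Restricted orthogonality. -/
theorem RestrictedIsometry.frobInner_gram_le {m n k : ℕ} {A : Fin m → Matrix (Fin n) (Fin n) ℝ}
    {δ : ℝ} (h : RestrictedIsometry A k δ) {X Y : Matrix (Fin n) (Fin n) ℝ}
    (hk : X.rank + Y.rank ≤ k) (hXY : frobInner X Y = 0) :
    -frobInner (gram A X) Y ≤ δ * (√(frobSq X) * √(frobSq Y)) := by
  have hx2 := Real.sq_sqrt (frobSq_nonneg X)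
  have hy2 := Real.sq_sqrt (frobSq_nonneg Y)
  rcases (Real.sqrt_nonneg (frobSq X)).eq_or_lt with hx | hx
  · rw [← hx] at hx2
    have : X = 0 := (frobSq_eq_zero_iff X).1 (by rw [← hx2]; norm_num)
    rw [frobInner_gram_comm, this]; simp [frobInner, frobSq]
  rcases (Real.sqrt_nonneg (frobSq Y)).eq_or_lt with hy | hy
  · rw [← hy] at hy2
    have : Y = 0 := (frobSq_eq_zero_iff Y).1 (by rw [← hy2]; norm_num)
    rw [this]; simp [frobInner, frobSq]
  set x := √(frobSq X)
  set y := √(frobSq Y)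
  have hr : ∀ c : ℝ, (X + c • Y).rank ≤ k := fun c =>
    (matrix_rank_add_le _ _).trans ((Nat.add_le_add_left (rank_smul_le c Y) _).trans hk)
  have hf : ∀ c : ℝ, frobSq (X + c • Y) = x ^ 2 + c ^ 2 * y ^ 2 := by
    intro c
    rw [frobSq_add, frobInner_smul_right, hXY, frobSq_smul, hx2, hy2]; ring
  have hm : ∀ c : ℝ, ∑ i, meas A (X + c • Y) i ^ 2 =
      ∑ i, meas A X i ^ 2 + 2 * c * frobInner (gram A X) Y + c ^ 2 * ∑ i, meas A Y i ^ 2 := by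
    intro c
    rw [sum_meas_add_sq, frobInner_smul_right, meas_smul]
    simp only [Pi.smul_apply, smul_eq_mul, mul_pow, ← Finset.mul_sum]
    ring
  -- The scaling `x / y` gives both orthogonal summands norm `x`, so `X ± (x / y) Y` have squared
  -- norm `2x²`. Subtracting the isometry bounds cancels everything except the cross term and `δ`.
  have h1 := (h _ (hr (x / y))).2
  have h2 := (h _ (hr (-(x / y)))).1
  have h3 := (h _ (hr (x / y))).1
  have h4 := (h _ (hr (-(x / y)))).2
  rw [hf, hm] at h1 h2 h3 h4
  have e : (x / y) ^ 2 * y ^ 2 = x ^ 2 := by field_simp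
  rw [neg_sq, e] at h2 h4
  rw [e] at h1 h3
  have h5 : (x / y) * -frobInner (gram A X) Y ≤ (x / y) * (δ * (x * y)) := by
    have : (x / y) * (δ * (x * y)) = δ * x ^ 2 := by field_simp
    rw [this]
    nlinarith
  exact le_of_mul_le_mul_left h5 (by positivity)

/-! ### Stability of nuclear norm minimisation -/

theorem nuclearNorm_zero {n : ℕ} : nuclearNorm (0 : Matrix (Fin n) (Fin n) ℝ) = 0 := by
  obtain ⟨W, -, h⟩ := exists_frobInner_eq_nuclearNorm (0 : Matrix (Fin n) (Fin n) ℝ)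
  rw [← h]; simp [frobInner]

theorem eq_zero_of_rank_eq_zero {n : ℕ} {X : Matrix (Fin n) (Fin n) ℝ} (h : X.rank = 0) : X = 0 := by
  have := nuclearNorm_sq_le X
  rw [h] at this
  have h2 := frobSq_le_nuclearNorm_sq X
  exact (frobSq_eq_zero_iff X).1 (le_antisymm (by simp at this; simpa [this] using h2) (frobSq_nonneg X))

/-- Stability of nuclear norm minimisation under the restricted isometry property. -/
theorem frobSq_le_of_nuclearNorm_le {m n r : ℕ} {A : Fin m → Matrix (Fin n) (Fin n) ℝ}
    (hA : RestrictedIsometry A (4 * r) (5 / 12)) {M h : Matrix (Fin n) (Fin n) ℝ} {τ : ℝ}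
    (hM : M.rank ≤ r) (hle : nuclearNorm (M + h) ≤ nuclearNorm M)
    (hG : opNorm (gram A h) ≤ τ) :
    frobSq h ≤ 4608 * M.rank * τ ^ 2 := by
  rcases Nat.eq_zero_or_pos M.rank with hk | hk
  · have hM0 := eq_zero_of_rank_eq_zero hk
    rw [hM0, zero_add, nuclearNorm_zero] at hle
    have h1 : nuclearNorm h = 0 := le_antisymm hle (nuclearNorm_nonneg h)
    have h2 := frobSq_le_nuclearNorm_sq h
    rw [h1] at h2
    rw [hk]; simpa using h2
  obtain ⟨h₀, hc, hsum, hrank, hcone, horth⟩ := exists_cone_decomposition M h hle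
  set k := M.rank
  have hτ : 0 ≤ τ := (opNorm_nonneg _).trans hG
  -- Blocks of length `2k` match the rank bound of `h₀`: the factors `√(2k)` cancel in `hηa`, and
  -- `h₀ + H 0` still has rank at most `4k`.
  obtain ⟨H, hH, hHr, hHL, hHR, hHo, hHs⟩ := exists_block_decomposition hc (q := 2 * k) (by omega)
  have ho : ∀ j, frobInner h₀ (H j) = 0 := by
    intro j
    obtain ⟨L, hL⟩ := hHL j
    obtain ⟨R, hR⟩ := hHR j
    exact horth _ L R hL hR
  rw [Finset.sum_range_succ'] at hH
  set T := ∑ j ∈ Finset.range n, H (j + 1) with hT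
  set η : ℕ → ℝ := fun j => √(frobSq (H (j + 1)))
  set a := √(frobSq h₀)
  set b := √(frobSq (H 0))
  have ha2 : a ^ 2 = frobSq h₀ := Real.sq_sqrt (frobSq_nonneg _)
  have hb2 : b ^ 2 = frobSq (H 0) := Real.sq_sqrt (frobSq_nonneg _)
  have ha0 : 0 ≤ a := Real.sqrt_nonneg _
  have hb0 : 0 ≤ b := Real.sqrt_nonneg _
  have hη0 : ∀ j, 0 ≤ η j := fun j => Real.sqrt_nonneg _
  have hkR : (0 : ℝ) < k := by exact_mod_cast hk
  have hηa : ∑ j ∈ Finset.range n, η j ≤ a := by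
    have h1 : nuclearNorm h₀ ≤ √((2 * k : ℕ) : ℝ) * a := by
      rw [← Real.sqrt_mul (by positivity)]
      refine Real.le_sqrt_of_sq_le ((nuclearNorm_sq_le h₀).trans ?_)
      gcongr
      exact frobSq_nonneg _
    have h2 := hHs.trans (hcone.trans h1)
    rw [mul_comm] at h2
    exact le_of_mul_le_mul_left h2 (Real.sqrt_pos.2 (by exact_mod_cast (by omega : 0 < 2 * k)))
  set h01 := h₀ + H 0 with hh01
  have hh : h = h01 + T := by rw [hsum, hH, hh01]; abel
  have hf01 : frobSq h01 = a ^ 2 + b ^ 2 := by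
    rw [hh01, frobSq_add, ho 0, ha2, hb2]; ring
  have hr01 : h01.rank ≤ 4 * k := by
    have : h01.rank ≤ _ := matrix_rank_add_le h₀ (H 0)
    have := hHr 0
    omega
  have hoT : frobInner h01 T = 0 := by
    rw [hT, frobInner_sum_right]
    refine Finset.sum_eq_zero fun j _ => ?_
    rw [hh01, frobInner_add_left, ho, hHo _ _ (by omega), add_zero]
  have hfT : frobSq T ≤ a ^ 2 := by
    have h1 : frobSq T = ∑ j ∈ Finset.range n, η j ^ 2 := by
      rw [← frobInner_self, hT, frobInner_sum_left]
      refine Finset.sum_congr rfl fun i hi => ?_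
      rw [frobInner_sum_right, Finset.sum_eq_single_of_mem i hi, frobInner_self]
      · exact (Real.sq_sqrt (frobSq_nonneg _)).symm
      · intro j _ hj
        exact hHo _ _ (by omega)
    rw [h1]
    refine (Finset.sum_sq_le_sq_sum_of_nonneg fun i _ => hη0 i).trans ?_
    exact pow_le_pow_left₀ (Finset.sum_nonneg fun i _ => hη0 i) hηa 2
  have hlow := (hA h01 (by omega)).1
  rw [← frobInner_gram_self] at hlow
  have hsplit : frobInner (gram A h01) h01 =
      frobInner (gram A h) h01 + ∑ j ∈ Finset.range n, -frobInner (gram A h01) (H (j + 1)) := by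
    rw [Finset.sum_neg_distrib, ← frobInner_sum_right, ← hT, frobInner_gram_comm A h h01]
    have := frobInner_add_right (gram A h01) h01 T
    rw [← hh] at this
    linarith
  have htail : ∑ j ∈ Finset.range n, -frobInner (gram A h01) (H (j + 1)) ≤ 5 / 12 * (a + b) * a := by
    have h1 : ∀ j ∈ Finset.range n, -frobInner (gram A h01) (H (j + 1)) ≤ 5 / 12 * (a + b) * η j := by
      intro j _
      have := hHr 0
      have := hHr (j + 1)
      have k1 := hA.frobInner_gram_le (X := h₀) (Y := H (j + 1)) (by omega) (ho _)
      have k2 := hA.frobInner_gram_le (X := H 0) (Y := H (j + 1)) (by omega) (hHo _ _ (by omega))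
      rw [hh01, gram_add, frobInner_add_left]
      linarith
    refine (Finset.sum_le_sum h1).trans ?_
    rw [← Finset.mul_sum]
    gcongr
  set s := √(a ^ 2 + b ^ 2)
  have hs2 : s ^ 2 = a ^ 2 + b ^ 2 := Real.sq_sqrt (by positivity)
  have hs0 : 0 ≤ s := Real.sqrt_nonneg _
  have hmain : frobInner (gram A h) h01 ≤ 2 * √k * s * τ := by
    rw [frobInner_comm]
    refine (frobInner_le_nuclearNorm_mul_opNorm _ _).trans ?_
    have h1 : nuclearNorm h01 ≤ 2 * √k * s := by
      refine le_of_sq_le_sq ?_ (by positivity)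
      refine (nuclearNorm_sq_le h01).trans ?_
      rw [mul_pow, mul_pow, Real.sq_sqrt hkR.le, hs2, hf01]
      have : (h01.rank : ℝ) ≤ 4 * k := by exact_mod_cast hr01
      have : 0 ≤ a ^ 2 + b ^ 2 := by positivity
      nlinarith
    exact mul_le_mul h1 hG (opNorm_nonneg _) (by positivity)
  have hs : s ≤ 48 * √k * τ := by
    rw [hf01] at hlow
    have h1 : s * s ≤ s * (48 * √k * τ) := by
      -- Isometry and orthogonality leave `7/12 (a² + b²) - 5/12 (a + b) a ≤ 2 √k s τ`. The left
      -- side is at least `s² / 24`, since `3a² - 10ab + 13b² ≥ 0`; this produces `48`, and `2 · 48²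
      -- = 4608`.
      nlinarith [sq_nonneg (3 * a - 5 * b), sq_nonneg b]
    rcases hs0.eq_or_lt with h0 | h0
    · rw [← h0]; positivity
    · exact le_of_mul_le_mul_left h1 h0
  have hfin : frobSq h ≤ 2 * s ^ 2 := by
    rw [hh, frobSq_add, hoT, hf01, hs2]
    nlinarith [sq_nonneg b]
  have : s ^ 2 ≤ (48 * √k * τ) ^ 2 := pow_le_pow_left₀ hs0 hs 2
  rw [mul_pow, mul_pow, Real.sq_sqrt hkR.le] at this
  linarith

/-! ### Penalised low-rank approximation and the oracle inequality -/

theorem singVal_eq_zero_of_rank_le {n : ℕ} (X : Matrix (Fin n) (Fin n) ℝ) {i : ℕ}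
    (h : X.rank ≤ i) : singVal X i = 0 := by
  refine LinearMap.singularValues_eq_zero_iff_le_finrank_range _ |>.2 ?_
  change Module.finrank ℝ (LinearMap.range (toLpLin 2 2 X)) ≤ i
  rwa [toLpLin_eq_toLin, ← Matrix.rank_eq_finrank_range_toLin]

theorem sum_range_rank_min_singVal_sq {n : ℕ} (X : Matrix (Fin n) (Fin n) ℝ) {θ : ℝ} (hθ : 0 ≤ θ) :
    ∑ i ∈ Finset.range X.rank, min (singVal X i ^ 2) θ = ∑ i : Fin n, min (singVal X i ^ 2) θ := by
  rw [← Finset.sum_range (fun i => min (singVal X i ^ 2) θ)]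
  refine Finset.sum_subset ?_ ?_
  · exact Finset.range_subset_range.2 (by simpa using X.rank_le_card_width)
  · intro i _ hi
    rw [singVal_eq_zero_of_rank_le X (by simpa using hi)]
    simpa using hθ

/-- Discarding the small singular values. -/
theorem exists_truncation {n : ℕ} (M : Matrix (Fin n) (Fin n) ℝ) (θ : ℝ) :
    ∃ M₀ : Matrix (Fin n) (Fin n) ℝ,
      M₀.rank ≤ (Finset.univ.filter fun i : Fin n => θ < singVal M i ^ 2).card ∧
      (M₀ - M).rank ≤ M.rank ∧
      frobSq (M₀ - M) = ∑ i : Fin n, if θ < singVal M i ^ 2 then 0 else singVal M i ^ 2 := by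
  obtain ⟨U, V, hU, hV, hM⟩ := exists_svd M
  let s : Fin n → ℝ := fun i => singVal M i
  let s₀ : Fin n → ℝ := fun i => if θ < s i ^ 2 then s i else 0
  have hd : U * diagonal s₀ * Vᵀ - M = U * diagonal (fun i => s₀ i - s i) * Vᵀ := by
    have : diagonal (fun i => s₀ i - s i) = diagonal s₀ - diagonal s := (diagonal_sub _ _).symm
    rw [this, Matrix.mul_sub, Matrix.sub_mul]
    congr 1
  refine ⟨U * diagonal s₀ * Vᵀ, ?_, ?_, ?_⟩
  · rw [rank_mul_diagonal_mul hU hV]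
    refine Finset.card_le_card fun i hi => ?_
    simp only [Finset.mem_filter, Finset.mem_univ, true_and, s₀] at hi ⊢
    by_contra hc
    exact hi (if_neg hc)
  · rw [hd, rank_mul_diagonal_mul hU hV, rank_eq_card_singVal]
    refine Finset.card_le_card fun i hi => ?_
    simp only [Finset.mem_filter, Finset.mem_univ, true_and, s₀, s] at hi ⊢
    intro h0
    simp [h0] at hi
  · rw [hd, frobSq_mul_diagonal_mul hU hV]
    refine Finset.sum_congr rfl fun i _ => ?_
    simp only [s₀, s]
    split_ifs <;> simp

/-- An approximate minimiser suffices, so attainment of the infimum for the discontinuous rank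
penalty need not be discussed. Starting from `x₀` keeps the exact comparison `f x ≤ f x₀`. -/
theorem exists_near_minimizer {α : Type*} (f : α → ℝ) (hf : ∀ x, 0 ≤ f x) {ε : ℝ} (hε : 0 < ε)
    (x₀ : α) : ∃ x, f x ≤ f x₀ ∧ ∀ y, f x ≤ f y + ε := by
  have hbdd : BddBelow (Set.range f) := ⟨0, by rintro _ ⟨x, rfl⟩; exact hf x⟩
  by_cases h : f x₀ ≤ sInf (Set.range f) + ε
  · exact ⟨x₀, le_rfl, fun y => h.trans (by gcongr; exact csInf_le hbdd ⟨y, rfl⟩)⟩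
  · obtain ⟨_, ⟨x, rfl⟩, hx⟩ := exists_lt_of_csInf_lt (Set.range_nonempty_iff_nonempty.2 ⟨x₀⟩)
      (lt_add_of_pos_right (sInf (Set.range f)) hε)
    exact ⟨x, by linarith, fun y => hx.le.trans (by gcongr; exact csInf_le hbdd ⟨y, rfl⟩)⟩

theorem frobSq_zero {n : ℕ} : frobSq (0 : Matrix (Fin n) (Fin n) ℝ) = 0 := by simp [frobSq]

/-- A low-rank matrix close to `M` for which the gradient `A^* A (· - M)` is small: a near minimiser
of a rank-penalised least squares functional. -/
theorem exists_penalized_approximation {m n : ℕ} {A : Fin m → Matrix (Fin n) (Fin n) ℝ}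
    {M : Matrix (Fin n) (Fin n) ℝ} (hr : 1 ≤ M.rank)
    (hA : RestrictedIsometry A (4 * M.rank) (5 / 12)) {Λ θ : ℝ} (hΛ : 0 ≤ Λ)
    (hθ : Λ ^ 2 = 256 * θ) :
    ∃ N : Matrix (Fin n) (Fin n) ℝ, N.rank ≤ M.rank ∧ opNorm (gram A (N - M)) ≤ Λ ∧
      Λ ^ 2 / 3 * N.rank + ∑ i, meas A (N - M) i ^ 2 ≤
        86 * ∑ i ∈ Finset.range M.rank, min (singVal M i ^ 2) θ := by
  have hθ0 : 0 ≤ θ := by nlinarith [sq_nonneg Λ]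
  rw [sum_range_rank_min_singVal_sq M hθ0]
  rcases hΛ.eq_or_lt with h0 | hpos
  · refine ⟨M, le_rfl, ?_, ?_⟩
    · simp [← h0, gram, meas, measAdj, opNorm]
    · rw [← h0]
      have : 0 ≤ ∑ i : Fin n, min (singVal M i ^ 2) θ :=
        Finset.sum_nonneg fun i _ => le_min (sq_nonneg _) hθ0
      simpa [meas] using this
  obtain ⟨M₀, h1, h2, h3⟩ := exists_truncation M θ
  let K : Matrix (Fin n) (Fin n) ℝ → ℝ := fun X => Λ ^ 2 / 3 * X.rank + ∑ i, meas A (X - M) i ^ 2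
  have hS : ∀ X : Matrix (Fin n) (Fin n) ℝ, 0 ≤ ∑ i, meas A X i ^ 2 :=
    fun X => Finset.sum_nonneg fun i _ => sq_nonneg _
  obtain ⟨N, hN, hmin⟩ := exists_near_minimizer K (fun X => add_nonneg (by positivity) (hS _))
    (show 0 < Λ ^ 2 / 6 by positivity) M₀
  refine ⟨N, ?_, ?_, hN.trans ?_⟩
  · have hM := hmin M
    have e : K M = Λ ^ 2 / 3 * M.rank := by simp [K, meas]
    rw [e] at hM
    have : Λ ^ 2 / 3 * N.rank ≤ K N := le_add_of_nonneg_right (hS _)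
    have h4 : Λ ^ 2 * (N.rank : ℝ) < Λ ^ 2 * (M.rank + 1 : ℝ) := by nlinarith [pow_pos hpos 2]
    have h5 := lt_of_mul_lt_mul_left h4 (sq_nonneg _)
    exact Nat.lt_succ_iff.1 (by exact_mod_cast h5)
  · refine opNorm_le_of_forall_dotProduct hΛ fun u v hu hv => ?_
    by_contra! hlt
    rw [← frobInner_vecMulVec] at hlt
    set R := vecMulVec u v
    have hR : R.rank ≤ 1 := rank_vecMulVec_le u v
    have hRf : frobSq R = 1 := by rw [frobSq_vecMulVec, hu, hv, one_mul]
    have hRm := (hA R (by omega)).2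
    rw [hRf] at hRm
    -- If the gradient exceeds `Λ` in direction `R`, this step changes `K` by less than `Λ²/3 -
    -- 4Λ²/3 + (4/9)(17/12)Λ² = -10Λ²/27`, a larger drop than the slack `Λ²/6` permits.
    have hY := hmin (N + (-(2 * Λ / 3)) • R)
    have hYr : ((N + (-(2 * Λ / 3)) • R).rank : ℝ) ≤ N.rank + 1 := by
      exact_mod_cast (matrix_rank_add_le _ _).trans
        (Nat.add_le_add_left ((rank_smul_le _ _).trans hR) _)
    have hYs : ∑ i, meas A (N + (-(2 * Λ / 3)) • R - M) i ^ 2 = ∑ i, meas A (N - M) i ^ 2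
        - 4 * Λ / 3 * frobInner R (gram A (N - M)) + (2 * Λ / 3) ^ 2 * ∑ i, meas A R i ^ 2 := by
      rw [show N + (-(2 * Λ / 3)) • R - M = (N - M) + (-(2 * Λ / 3)) • R by abel, sum_meas_add_sq,
        frobInner_smul_right, meas_smul, frobInner_comm _ R]
      simp only [Pi.smul_apply, smul_eq_mul, mul_pow, ← Finset.mul_sum]
      ring
    simp only [K] at hY
    rw [hYs] at hY
    have h6 : Λ ^ 2 / 3 * ((N + (-(2 * Λ / 3)) • R).rank : ℝ) ≤ Λ ^ 2 / 3 * (N.rank + 1) := by gcongr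
    have h7 : (2 * Λ / 3) ^ 2 * ∑ i, meas A R i ^ 2 ≤ (2 * Λ / 3) ^ 2 * ((1 + 5 / 12) * 1) := by gcongr
    have h8 : Λ * Λ < Λ * frobInner R (gram A (N - M)) := by gcongr
    nlinarith [pow_pos hpos 2]
  · have h4 := (hA (M₀ - M) (by omega)).2
    have h5 : (M₀.rank : ℝ) ≤ ∑ i : Fin n, if θ < singVal M i ^ 2 then (1 : ℝ) else 0 := by
      rw [Finset.sum_boole]; exact_mod_cast h1
    have h6 : Λ ^ 2 / 3 * (M₀.rank : ℝ) ≤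
        Λ ^ 2 / 3 * ∑ i : Fin n, if θ < singVal M i ^ 2 then (1 : ℝ) else 0 := by gcongr
    refine (add_le_add h6 h4).trans ?_
    rw [h3, Finset.mul_sum, Finset.mul_sum, Finset.mul_sum, ← Finset.sum_add_distrib]
    refine Finset.sum_le_sum fun i _ => ?_
    split_ifs with hi
    -- A retained singular value costs `Λ²/3 = 256θ/3 ≤ 86θ`; a discarded one costs `17/12` of its
    -- square.
    · rw [min_eq_right hi.le, hθ]; linarith
    · rw [min_eq_left (not_lt.1 hi)]; nlinarith [sq_nonneg (singVal M i)]

/-- The oracle inequality for a fixed noise vector. -/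
theorem IsDantzigSolution.frobSq_sub_le {m n : ℕ} {A : Fin m → Matrix (Fin n) (Fin n) ℝ}
    {M X : Matrix (Fin n) (Fin n) ℝ} (hr : 1 ≤ M.rank)
    (hA : RestrictedIsometry A (4 * M.rank) (5 / 12)) {Λ θ : ℝ} (hΛ : 0 ≤ Λ)
    (hθ : Λ ^ 2 = 256 * θ) {z : Fin m → ℝ} (hz : opNorm (measAdj A z) ≤ Λ)
    (hX : IsDantzigSolution A (meas A M + z) (2 * Λ) X) :
    frobSq (X - M) ≤ 40000000 * ∑ i ∈ Finset.range M.rank, min (singVal M i ^ 2) θ := by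
  obtain ⟨N, hN1, hN2, hN3⟩ := exists_penalized_approximation hr hA hΛ hθ
  have hNf : DantzigFeasible A (meas A M + z) (2 * Λ) N := by
    have : measAdj A (meas A M + z - meas A N) = measAdj A z + -gram A (N - M) := by
      rw [gram, meas_sub, measAdj_sub, measAdj_sub, measAdj_add]; abel
    rw [DantzigFeasible, this]
    refine (opNorm_add_le _ _).trans ?_
    rw [opNorm_neg]; linarith
  have hh : opNorm (gram A (X - N)) ≤ 4 * Λ := by
    have : gram A (X - N) =
        measAdj A (meas A M + z - meas A N) + -measAdj A (meas A M + z - meas A X) := by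
      rw [gram, meas_sub, measAdj_sub, measAdj_sub, measAdj_sub]; abel
    rw [this]
    refine (opNorm_add_le _ _).trans ?_
    rw [opNorm_neg]
    have k1 : opNorm (measAdj A (meas A M + z - meas A N)) ≤ 2 * Λ := hNf
    have k2 : opNorm (measAdj A (meas A M + z - meas A X)) ≤ 2 * Λ := hX.1
    linarith
  have h1 := frobSq_le_of_nuclearNorm_le hA (M := N) (h := X - N) hN1
    (by rw [add_sub_cancel]; exact hX.2 N hNf) hh
  have h2 := (hA (N - M) ((matrix_rank_sub_le _ _).trans (by omega))).1
  have h3 : frobSq (X - M) ≤ 2 * frobSq (X - N) + 2 * frobSq (N - M) := by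
    have e : X - M = (X - N) + (N - M) := by abel
    have k1 := frobSq_add (X - N) (N - M)
    have k2 := frobSq_add (X - N) ((-1 : ℝ) • (N - M))
    rw [frobInner_smul_right, frobSq_smul] at k2
    have k3 := frobSq_nonneg ((X - N) + (-1 : ℝ) • (N - M))
    rw [e]; linarith
  have h4 : 0 ≤ Λ ^ 2 * N.rank := by positivity
  have h5 : 0 ≤ ∑ i, meas A (N - M) i ^ 2 := Finset.sum_nonneg fun i _ => sq_nonneg _
  -- The error is at most `2 · 4608 · 16 Λ² rank(N) + (24/7) ‖A(N - M)‖²`. The penalised bound turns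
  -- this into at most `442368 · 86` times the sum, below `40000000`.
  nlinarith

/-! ### Existence of solutions by compactness -/

theorem nuclearNorm_add_le {n : ℕ} (X Y : Matrix (Fin n) (Fin n) ℝ) :
    nuclearNorm (X + Y) ≤ nuclearNorm X + nuclearNorm Y := by
  obtain ⟨W, hW, h⟩ := exists_frobInner_eq_nuclearNorm (X + Y)
  rw [← h, frobInner_add_left]
  refine add_le_add ?_ ?_
  · exact (frobInner_le_nuclearNorm_mul_opNorm _ _).trans
      (mul_le_of_le_one_right (nuclearNorm_nonneg _) hW)
  · exact (frobInner_le_nuclearNorm_mul_opNorm _ _).trans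
      (mul_le_of_le_one_right (nuclearNorm_nonneg _) hW)

theorem nuclearNorm_le_sqrt {n : ℕ} (X : Matrix (Fin n) (Fin n) ℝ) :
    nuclearNorm X ≤ √(n * frobSq X) := by
  refine Real.le_sqrt_of_sq_le ((nuclearNorm_sq_le X).trans ?_)
  gcongr
  · exact frobSq_nonneg X
  · simpa using X.rank_le_card_width

theorem frobSq_neg {n : ℕ} (X : Matrix (Fin n) (Fin n) ℝ) : frobSq (-X) = frobSq X := by
  simp [frobSq]

theorem continuous_nuclearNorm {n : ℕ} :
    Continuous (nuclearNorm : Matrix (Fin n) (Fin n) ℝ → ℝ) := by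
  rw [continuous_iff_continuousAt]
  intro X
  rw [ContinuousAt, tendsto_iff_dist_tendsto_zero]
  have hlim : Filter.Tendsto (fun Y : Matrix (Fin n) (Fin n) ℝ => √(n * frobSq (Y - X)))
      (nhds X) (nhds 0) := by
    have hc : Continuous fun Y : Matrix (Fin n) (Fin n) ℝ => √(n * frobSq (Y - X)) := by
      unfold frobSq
      fun_prop
    have := hc.tendsto X
    simpa [frobSq_zero] using this
  refine squeeze_zero (fun _ => dist_nonneg) (fun Y => ?_) hlim
  have h1 := nuclearNorm_add_le X (Y - X)
  have h2 := nuclearNorm_add_le Y (X - Y)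
  have h3 := nuclearNorm_le_sqrt (Y - X)
  have h4 := nuclearNorm_le_sqrt (X - Y)
  rw [← neg_sub Y X, frobSq_neg, neg_sub] at h4
  rw [add_sub_cancel] at h1 h2
  rw [Real.dist_eq, abs_le]
  constructor <;> linarith

theorem continuous_opNorm {n : ℕ} : Continuous (opNorm : Matrix (Fin n) (Fin n) ℝ → ℝ) := by
  have : Continuous (toEuclideanCLM (n := Fin n) (𝕜 := ℝ)) :=
    LinearMap.continuous_of_finiteDimensional
      (toEuclideanCLM (n := Fin n) (𝕜 := ℝ)).toAlgEquiv.toLinearMap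
  exact this.norm

/-- A feasible matrix Dantzig selector has a solution. -/
theorem DantzigFeasible.exists_isDantzigSolution {m n : ℕ} {A : Fin m → Matrix (Fin n) (Fin n) ℝ}
    {y : Fin m → ℝ} {lam : ℝ} {X₀ : Matrix (Fin n) (Fin n) ℝ} (h : DantzigFeasible A y lam X₀) :
    ∃ X, IsDantzigSolution A y lam X := by
  have hcl : IsClosed {X | DantzigFeasible A y lam X} := by
    refine isClosed_le (continuous_opNorm.comp ?_) continuous_const
    unfold measAdj meas
    simp only [Pi.sub_apply]
    fun_prop
  have hcl2 : IsClosed {X : Matrix (Fin n) (Fin n) ℝ | nuclearNorm X ≤ nuclearNorm X₀} :=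
    isClosed_le continuous_nuclearNorm continuous_const
  have hbox : IsCompact {X : Matrix (Fin n) (Fin n) ℝ |
      ∀ i, X i ∈ {x : Fin n → ℝ | ∀ j, x j ∈ Set.Icc (-nuclearNorm X₀) (nuclearNorm X₀)}} :=
    isCompact_pi_infinite fun _ => isCompact_pi_infinite fun _ => isCompact_Icc
  have hsub : {X : Matrix (Fin n) (Fin n) ℝ | nuclearNorm X ≤ nuclearNorm X₀} ⊆
      {X : Matrix (Fin n) (Fin n) ℝ |
      ∀ i, X i ∈ {x : Fin n → ℝ | ∀ j, x j ∈ Set.Icc (-nuclearNorm X₀) (nuclearNorm X₀)}} := by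
    intro X hX i j
    have hX : nuclearNorm X ≤ nuclearNorm X₀ := hX
    have h1 : X i j ^ 2 ≤ frobSq X :=
      (Finset.single_le_sum (f := fun j => X i j ^ 2) (fun j _ => sq_nonneg _)
        (Finset.mem_univ j)).trans
      (Finset.single_le_sum (f := fun i => ∑ j, X i j ^ 2)
        (fun i _ => Finset.sum_nonneg fun j _ => sq_nonneg _) (Finset.mem_univ i))
    exact abs_le.1 ((abs_le_of_sq_le_sq (h1.trans (frobSq_le_nuclearNorm_sq X))
      (nuclearNorm_nonneg X)).trans hX)
  have hK := (hbox.of_isClosed_subset hcl2 hsub).inter_right hcl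
  obtain ⟨X, hX, hmin⟩ := hK.exists_isMinOn ⟨X₀, le_refl (nuclearNorm X₀), h⟩ continuous_nuclearNorm.continuousOn
  refine ⟨X, hX.2, fun Y hY => ?_⟩
  rcases le_total (nuclearNorm Y) (nuclearNorm X₀) with hle | hle
  · exact hmin ⟨hle, hY⟩
  · exact le_trans hX.1 hle

/-! ### Norming sets for the operator norm -/

/-- A finite set of at most `5 ^ n` points of the sphere of radius `2` that norms Euclidean space. -/
theorem exists_norming_finset (n : ℕ) :
    ∃ s : Finset (EuclideanSpace ℝ (Fin n)), s.card ≤ 5 ^ n ∧ (∀ c ∈ s, ‖c‖ = 2) ∧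
      ∀ w, w ≠ 0 → ∃ c ∈ s, ‖w‖ ≤ inner ℝ c w := by
  classical
  let S : Finset (EuclideanSpace ℝ (Fin n)) → Prop := fun s =>
    (∀ c ∈ s, ‖c‖ = 2) ∧ ∀ c ∈ s, ∀ d ∈ s, c ≠ d → 1 ≤ ‖c - d‖
  have hcard : ∀ s, S s → s.card ≤ 5 ^ n := by
    intro s hs
    have := Besicovitch.card_le_of_separated s (fun c hc => (hs.1 c hc).le) hs.2
    simpa using this
  -- A `1`-separated set of maximal cardinality on the sphere of radius `2`: maximality puts every
  -- point `x` of that sphere within `1` of some `c`. For `x` parallel to `w` this gives `⟪c, w⟫ ≥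
  -- 2‖w‖ - ‖w‖`.
  have hmem := Nat.sSup_mem (s := {k | ∃ s, S s ∧ s.card = k})
    ⟨0, ∅, ⟨by simp, by simp⟩, rfl⟩ ⟨5 ^ n, by rintro _ ⟨s, hs, rfl⟩; exact hcard s hs⟩
  obtain ⟨s, hs, hsc⟩ := hmem
  have hmax : ∀ t, S t → t.card ≤ s.card := by
    intro t ht
    rw [hsc]
    exact le_csSup ⟨5 ^ n, by rintro _ ⟨s, hs, rfl⟩; exact hcard s hs⟩ ⟨t, ht, rfl⟩
  refine ⟨s, hcard s hs, hs.1, fun w hw => ?_⟩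
  have hwn : 0 < ‖w‖ := norm_pos_iff.2 hw
  set x := (2 / ‖w‖) • w with hx
  have hxn : ‖x‖ = 2 := by
    rw [hx, norm_smul, Real.norm_of_nonneg (by positivity)]; field_simp
  have hnear : ∃ c ∈ s, ‖x - c‖ ≤ 1 := by
    by_contra! hfar
    have hxs : x ∉ s := fun h => by simpa using (hfar x h).trans_le' zero_le_one
    have := hmax (insert x s) ⟨by simpa [hxn] using hs.1, by
      intro c hc d hd hcd
      rcases Finset.mem_insert.1 hc with rfl | hc <;> rcases Finset.mem_insert.1 hd with rfl | hd
      · exact absurd rfl hcd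
      · exact (hfar d hd).le
      · rw [norm_sub_rev]; exact (hfar c hc).le
      · exact hs.2 c hc d hd hcd⟩
    rw [Finset.card_insert_of_notMem hxs] at this
    omega
  obtain ⟨c, hc, hxc⟩ := hnear
  refine ⟨c, hc, ?_⟩
  have h1 : inner ℝ x w = 2 * ‖w‖ := by
    rw [hx, inner_smul_left, real_inner_self_eq_norm_sq]
    simp; field_simp
  have h2 := real_inner_le_norm (x - c) w
  rw [inner_sub_left, h1] at h2
  nlinarith

/-- The operator norm is controlled by the bilinear form on a norming set. -/
theorem opNorm_le_of_norming {n : ℕ} {s : Finset (EuclideanSpace ℝ (Fin n))}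
    (hs : ∀ w, w ≠ 0 → ∃ c ∈ s, ‖w‖ ≤ inner ℝ c w) {G : Matrix (Fin n) (Fin n) ℝ} {T : ℝ}
    (hT : 0 ≤ T) (h : ∀ c ∈ s, ∀ d ∈ s, c.ofLp ⬝ᵥ G *ᵥ d.ofLp ≤ T) : opNorm G ≤ T := by
  have hn : ∀ w : Fin n → ℝ, √(w ⬝ᵥ w) = ‖(WithLp.toLp 2 w : EuclideanSpace ℝ (Fin n))‖ := by
    intro w
    rw [EuclideanSpace.norm_eq]
    simp [dotProduct, sq]
  have hs' : ∀ w : Fin n → ℝ, w ≠ 0 → ∃ c ∈ s, √(w ⬝ᵥ w) ≤ c.ofLp ⬝ᵥ w := by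
    intro w hw
    obtain ⟨c, hc, hcw⟩ := hs (WithLp.toLp 2 w) (by simpa using hw)
    refine ⟨c, hc, ?_⟩
    rw [hn]
    simpa [EuclideanSpace.inner_eq_star_dotProduct, dotProduct_comm] using hcw
  have hcs : ∀ u v : Fin n → ℝ, u ⬝ᵥ v ≤ √(u ⬝ᵥ u) * √(v ⬝ᵥ v) := by
    intro u v
    rw [hn, hn]
    have := real_inner_le_norm (WithLp.toLp 2 u : EuclideanSpace ℝ (Fin n)) (WithLp.toLp 2 v)
    simpa [EuclideanSpace.inner_eq_star_dotProduct, dotProduct_comm] using this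
  have h1 : ∀ d ∈ s, √((G *ᵥ d.ofLp) ⬝ᵥ (G *ᵥ d.ofLp)) ≤ T := by
    intro d hd
    by_cases h0 : G *ᵥ d.ofLp = 0
    · simpa [h0] using hT
    · obtain ⟨c, hc, hcw⟩ := hs' _ h0
      exact hcw.trans (h c hc d hd)
  refine opNorm_le_of_forall_dotProduct hT fun u v hu hv => ?_
  have e : ∀ w : Fin n → ℝ, u ⬝ᵥ G *ᵥ w = (Gᵀ *ᵥ u) ⬝ᵥ w := by
    intro w
    rw [dotProduct_mulVec, mulVec_transpose]
  have h2 : √((Gᵀ *ᵥ u) ⬝ᵥ (Gᵀ *ᵥ u)) ≤ T := by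
    by_cases h0 : Gᵀ *ᵥ u = 0
    · simpa [h0] using hT
    · obtain ⟨d, hd, hdw⟩ := hs' _ h0
      rw [dotProduct_comm d.ofLp, ← e d.ofLp] at hdw
      -- The norming set is used twice: `d` norms `Gᵀ u`, and the resulting `⟪u, G d⟫` is bounded by
      -- `‖G d‖`, itself normed by the set in `h1`.
      have := hcs u (G *ᵥ d.ofLp)
      rw [hu, Real.sqrt_one, one_mul] at this
      exact hdw.trans (this.trans (h1 d hd))
  rw [e]
  have := hcs (Gᵀ *ᵥ u) v
  rw [hv, Real.sqrt_one, mul_one] at this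
  exact this.trans h2

/-! ### Gaussian tails and the noise event -/

section Gaussian

variable {Ω : Type*} [MeasurableSpace Ω] {μ : Measure Ω}

theorem hasSubgaussianMGF_of_hasLaw_gaussianReal {X : Ω → ℝ} {v : NNReal}
    (h : HasLaw X (gaussianReal 0 v) μ) : HasSubgaussianMGF X v μ where
  integrable_exp_mul t := by
    have h1 : Integrable (fun x => Real.exp (t * x)) (μ.map X) := by
      rw [h.map_eq]; exact integrable_exp_mul_gaussianReal t
    exact h1.comp_aemeasurable h.aemeasurable
  mgf_le t := by
    rw [mgf_gaussianReal h.map_eq]; simp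

theorem hasSubgaussianMGF_weaken {X : Ω → ℝ} {c d : NNReal} (h : HasSubgaussianMGF X c μ)
    (hcd : c ≤ d) : HasSubgaussianMGF X d μ where
  integrable_exp_mul := h.integrable_exp_mul
  mgf_le t := by
    refine (h.mgf_le t).trans (Real.exp_le_exp.2 ?_)
    gcongr

/-- Tail bound for a linear combination of independent Gaussian variables. -/
theorem measure_sum_mul_gaussian_ge_le {m : ℕ} {z : Fin m → Ω → ℝ} {σ : ℝ}
    (hind : iIndepFun z μ)
    (hz : ∀ i, HasLaw (z i) (gaussianReal 0 (Real.toNNReal (σ ^ 2))) μ) (a : Fin m → ℝ) {b T : ℝ}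
    (hb : ∑ i, a i ^ 2 ≤ b) (hT : 0 ≤ T) :
    μ.real {ω | T ≤ ∑ i, a i * z i ω} ≤ Real.exp (-T ^ 2 / (2 * (b * σ ^ 2))) := by
  have hb0 : 0 ≤ b := (Finset.sum_nonneg fun i _ => sq_nonneg _).trans hb
  have h0 : ∀ i, HasSubgaussianMGF (fun ω => a i * z i ω)
      (Real.toNNReal (a i ^ 2) * Real.toNNReal (σ ^ 2)) μ := fun i =>
    hasSubgaussianMGF_weaken ((hasSubgaussianMGF_of_hasLaw_gaussianReal (hz i)).const_mul (a i))
      (congrArg (· * Real.toNNReal (σ ^ 2)) (NNReal.eq (Real.coe_toNNReal _ (sq_nonneg _)).symm)).le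
  have h1 : iIndepFun (fun i ω => a i * z i ω) μ :=
    hind.comp (fun i x => a i * x) fun i => measurable_const_mul (a i)
  have h2 := HasSubgaussianMGF.sum_of_iIndepFun h1 (s := Finset.univ)
    fun i _ => h0 i
  have h3 := hasSubgaussianMGF_weaken h2 (d := Real.toNNReal (b * σ ^ 2)) (by
    rw [← NNReal.coe_le_coe, Real.coe_toNNReal _ (by positivity)]
    simp only [NNReal.coe_sum, NNReal.coe_mul, Real.coe_toNNReal _ (sq_nonneg _)]
    rw [← Finset.sum_mul]
    exact mul_le_mul_of_nonneg_right hb (sq_nonneg σ))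
  have h4 := h3.measure_ge_le hT
  rwa [Real.coe_toNNReal _ (by positivity)] at h4

theorem dotProduct_measAdj_mulVec {m n : ℕ} (A : Fin m → Matrix (Fin n) (Fin n) ℝ) (v : Fin m → ℝ)
    (c d : Fin n → ℝ) :
    c ⬝ᵥ measAdj A v *ᵥ d = ∑ i, meas A (vecMulVec c d) i * v i := by
  rw [← frobInner_vecMulVec, frobInner_comm, frobInner_measAdj]
  exact Finset.sum_congr rfl fun i _ => mul_comm _ _

/-- The union bound over pairs costs `25 ^ n ≤ exp (4n)`, while each tail contributes `exp
(-96n/17)`; the net exponent `-28n/17` is below `-n`. -/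
theorem exp_exponent_bound (n : ℕ) :
    (5 : ℝ) ^ n * 5 ^ n * Real.exp (-(96 / 17 * n)) ≤ Real.exp (-1 * n) := by
  have h5 : (5 : ℝ) ≤ Real.exp 2 := by
    have h := Real.exp_one_gt_d9
    have : Real.exp 2 = Real.exp 1 * Real.exp 1 := by rw [← Real.exp_add]; norm_num
    nlinarith
  have h5n : (5 : ℝ) ^ n ≤ Real.exp (2 * n) := by
    rw [mul_comm, Real.exp_nat_mul]
    exact pow_le_pow_left₀ (by norm_num) h5 n
  calc (5 : ℝ) ^ n * 5 ^ n * Real.exp (-(96 / 17 * n))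
      ≤ Real.exp (2 * n) * Real.exp (2 * n) * Real.exp (-(96 / 17 * n)) := by gcongr
    _ = Real.exp (2 * n + 2 * n + -(96 / 17 * n)) := by rw [Real.exp_add, Real.exp_add]
    _ ≤ Real.exp (-1 * n) := by
      refine Real.exp_le_exp.2 ?_
      have : (0 : ℝ) ≤ n := n.cast_nonneg
      linarith

/-- The noise matrix `A^* z` has operator norm at most `16 √n σ` with high probability. -/
theorem exists_event_opNorm_measAdj_le [IsProbabilityMeasure μ] {m n : ℕ}
    {A : Fin m → Matrix (Fin n) (Fin n) ℝ} (hA : RestrictedIsometry A 1 (5 / 12))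
    {z : Fin m → Ω → ℝ} {σ : ℝ} (hσ : 0 ≤ σ) (hind : iIndepFun z μ)
    (hz : ∀ i, HasLaw (z i) (gaussianReal 0 (Real.toNNReal (σ ^ 2))) μ) :
    ∃ E : Set Ω, MeasurableSet E ∧ 1 - Real.exp (-1 * n) ≤ μ.real E ∧
      ∀ ω ∈ E, opNorm (measAdj A fun i => z i ω) ≤ 16 * (√n * σ) := by
  -- The noise is only almost everywhere measurable, so the bad set is first bounded in outer
  -- measure and then replaced by its measurable hull.
  suffices h : ∃ B : Set Ω, μ.real B ≤ Real.exp (-1 * n) ∧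
      ∀ ω, ω ∉ B → opNorm (measAdj A fun i => z i ω) ≤ 16 * (√n * σ) by
    obtain ⟨B, hB, h⟩ := h
    refine ⟨(toMeasurable μ B)ᶜ, (measurableSet_toMeasurable _ _).compl, ?_, fun ω hω =>
      h ω fun hB' => hω (subset_toMeasurable μ B hB')⟩
    rw [probReal_compl_eq_one_sub (measurableSet_toMeasurable _ _), measureReal_def,
      measure_toMeasurable, ← measureReal_def]
    linarith
  -- For `σ = 0` the tail exponent has denominator zero, hence value `0`, and says nothing; here the
  -- noise vanishes almost surely.
  rcases hσ.eq_or_lt with h0 | hpos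
  · refine ⟨{ω | ¬ ∀ i, z i ω = 0}, ?_, fun ω hω => ?_⟩
    · have : ∀ᵐ ω ∂μ, ∀ i, z i ω = 0 := by
        rw [ae_all_iff]
        intro i
        have := hz i
        rw [← h0] at this
        simp only [ne_eq, OfNat.ofNat_ne_zero, not_false_eq_true, zero_pow, Real.toNNReal_zero,
          gaussianReal_zero_var] at this
        exact this.ae_eq_of_dirac
      have h1 : μ {ω | ¬ ∀ i, z i ω = 0} = 0 := this
      rw [measureReal_def, h1]
      simpa using (Real.exp_pos _).le
    · have hω : ∀ i, z i ω = 0 := by simpa using hω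
      simp [hω, measAdj, opNorm, ← h0]
  obtain ⟨s, hsc, hs2, hsn⟩ := exists_norming_finset n
  set T := 16 * (√n * σ) with hT
  have hT0 : 0 ≤ T := by positivity
  refine ⟨⋃ c ∈ s, ⋃ d ∈ s, {ω | T ≤ ∑ i, meas A (vecMulVec c.ofLp d.ofLp) i * z i ω}, ?_, ?_⟩
  · have htail : ∀ c ∈ s, ∀ d ∈ s,
        μ.real {ω | T ≤ ∑ i, meas A (vecMulVec c.ofLp d.ofLp) i * z i ω} ≤
          Real.exp (-(96 / 17 * n)) := by
      intro c hc d hd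
      have hn : ∀ w ∈ s, w.ofLp ⬝ᵥ w.ofLp = 4 := by
        intro w hw
        have h1 := EuclideanSpace.real_norm_sq_eq w
        rw [hs2 w hw] at h1
        simp only [dotProduct, ← sq]
        linarith
      have h1 := (hA (vecMulVec c.ofLp d.ofLp) (rank_vecMulVec_le _ _)).2
      rw [frobSq_vecMulVec, hn c hc, hn d hd] at h1
      refine (measure_sum_mul_gaussian_ge_le hind hz _ h1 hT0).trans (le_of_eq ?_)
      congr 1
      -- Norming vectors have squared length `4`, so the variance is at most `(17/12) · 16 σ²`, and
      -- `256n / (2 · (17/12) · 16) = 96n/17`.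
      rw [hT, mul_pow, mul_pow, Real.sq_sqrt n.cast_nonneg]
      field_simp
      ring
    calc _ ≤ ∑ c ∈ s, ∑ d ∈ s,
          μ.real {ω | T ≤ ∑ i, meas A (vecMulVec c.ofLp d.ofLp) i * z i ω} := by
          refine (measureReal_biUnion_finset_le _ _).trans (Finset.sum_le_sum fun c _ => ?_)
          exact measureReal_biUnion_finset_le _ _
      _ ≤ ∑ c ∈ s, ∑ d ∈ s, Real.exp (-(96 / 17 * n)) :=
          Finset.sum_le_sum fun c hc => Finset.sum_le_sum fun d hd => htail c hc d hd
      _ = (s.card : ℝ) * s.card * Real.exp (-(96 / 17 * n)) := by simp [mul_assoc]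
      _ ≤ (5 : ℝ) ^ n * 5 ^ n * Real.exp (-(96 / 17 * n)) := by
          have : (s.card : ℝ) ≤ 5 ^ n := by exact_mod_cast hsc
          gcongr
      _ ≤ _ := exp_exponent_bound n
  · intro ω hω
    refine opNorm_le_of_norming hsn hT0 fun c hc d hd => ?_
    rw [dotProduct_measAdj_mulVec]
    by_contra! hlt
    exact hω (Set.mem_biUnion hc (Set.mem_biUnion hd hlt.le))

end Gaussian

end LowRank

/-! ### Assembly of the oracle bound -/

theorem theorem2p4 :
    -- `K` is the constant in the choice `lam = K * √n * σ`; all four constants are numerical.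
    ∃ K C D d : ℝ, 0 < K ∧ 0 < C ∧ 0 < D ∧ 0 < d ∧
      ∀ (n m r : ℕ) (A : Fin m → Matrix (Fin n) (Fin n) ℝ) (M : Matrix (Fin n) (Fin n) ℝ) (σ : ℝ)
        (Ω : Type*) [MeasurableSpace Ω] (μ : Measure Ω) [IsProbabilityMeasure μ]
        (z : Fin m → Ω → ℝ),
        1 ≤ r → M.rank = r →
        LowRank.isometryConst A (4 * r) < √2 - 1 →
        0 ≤ σ →
        iIndepFun z μ →
        (∀ i, HasLaw (z i) (gaussianReal 0 (Real.toNNReal (σ ^ 2))) μ) →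
        ∃ E : Set Ω, MeasurableSet E ∧ 1 - D * Real.exp (-d * n) ≤ μ.real E ∧
          ∀ ω ∈ E,
            (∃ Mhat, LowRank.IsDantzigSolution A (LowRank.meas A M + fun i => z i ω)
              (K * √n * σ) Mhat) ∧
            ∀ Mhat, LowRank.IsDantzigSolution A (LowRank.meas A M + fun i => z i ω)
              (K * √n * σ) Mhat →
              LowRank.frobSq (Mhat - M) ≤
                C * ∑ i ∈ Finset.range r, min (LowRank.singVal M i ^ 2) (n * σ ^ 2) := by
  -- `32 = 2 · 16`: the constraint level is twice the noise bound, leaving room for both the noise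
  -- and the gradient at `N`.
  refine ⟨32, 40000000, 1, 1, by norm_num, by norm_num, by norm_num, by norm_num, ?_⟩
  rintro n m r A M σ Ω _ μ _ z hr rfl hδ hσ hind hz
  have hn : 1 ≤ n := hr.trans (by simpa using M.rank_le_card_width)
  have hδ' : LowRank.isometryConst A (4 * M.rank) ≤ 5 / 12 := by
    -- The rational number `5/12` lies just above `√2 - 1` and is still small enough for the
    -- stability estimate.
    have : √2 ≤ 17 / 12 := Real.sqrt_le_iff.2 ⟨by norm_num, by norm_num⟩
    linarith
  have hA : LowRank.RestrictedIsometry A (4 * M.rank) (5 / 12) :=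
    LowRank.RestrictedIsometry.mono (LowRank.isLeast_isometryConst A hn (by omega)).1 le_rfl hδ'
  obtain ⟨E, hE, hμ, hop⟩ :=
    LowRank.exists_event_opNorm_measAdj_le (hA.mono (by omega) le_rfl) hσ hind hz
  refine ⟨E, hE, by simpa using hμ, fun ω hω => ?_⟩
  have hz' := hop ω hω
  have hK : 32 * √n * σ = 2 * (16 * (√n * σ)) := by ring
  have hΛ : 0 ≤ 16 * (√n * σ) := by positivity
  rw [hK]
  refine ⟨LowRank.DantzigFeasible.exists_isDantzigSolution (X₀ := M) ?_, fun X hX => ?_⟩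
  · rw [LowRank.DantzigFeasible, add_sub_cancel_left]
    linarith
  · refine LowRank.IsDantzigSolution.frobSq_sub_le hr hA hΛ ?_ hz' hX
    rw [mul_pow, mul_pow, Real.sq_sqrt n.cast_nonneg]
    norm_num
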